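/- A crossed extension of groups is an exact sequence of groups $1\to B\xrightarrow{j} G_2\xrightarrow{\partial} G_1\xrightarrow{p} C\to 1$ in which $\partial$ is equipped with a crossed module structure; a morphism of crossed extensions is a morphism of exact sequences whose middle part $(f_1,f_2)$ is a morphism of crossed modules (i.e. equivariant). They form the category $\mathsf{XExt}(\mathsf{Gp})$. Let $\mathsf{Mod}(\mathsf{Gp})$ be the category of pairs $(C,B)$ of a group $C$ and a $C$-module $B$, with equivariant pairs of homomorphisms, $(\ )_0\colon\mathsf{Mod}(\mathsf{Gp})\to\mathsf{Gp}$, $(C,B)\mapsto C$, and let $\Pi\colon\mathsf{XExt}(\mathsf{Gp})\to\mathsf{Mod}(\mathsf{Gp})$ send a crossed extension to $(C,B)$ with the action of $C$ on $B$ induced by that of $G_1$ on $G_2$; put $\Pi_0=(\ )_0\cdot\Pi$. A morphism of crossed extensions is a weak equivalence if $\Pi$ sends it to an isomorphism. A butterfly from a crossed module $\partial_H\colon H_2\to H_1$ to $\partial_G\colon G_2\to G_1$ is a group $E$ with homomorphisms $\kappa\colon H_2\to E$, $\iota\colon G_2\to E$, $\delta\colon E\to H_1$, $\gamma\colon E\to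 G_1$ such that $\delta\kappa=\partial_H$, $\gamma\iota=\partial_G$, $\gamma\kappa=1$, the sequence $1\to G_2\xrightarrow{\iota}E\xrightarrow{\delta}H_1\to1$ is exact, and $\kappa(\delta(e)*h)=e\,\kappa(h)\,e^{-1}$, $\iota(\gamma(e)*g)=e\,\iota(g)\,e^{-1}$ for all $e\in E$, $h\in H_2$, $g\in G_2$. An isomorphism of butterflies is an isomorphism of the groups $E$ compatible with the four maps. The composite of $E\colon\partial_H\to\partial_G$ and $E'\colon\partial_G\to\partial_K$ is $(E\times_{G_1}E')/G_2$, where $G_2$ is embedded by $\langle\iota,\kappa'\rangle$, with the evident four maps. Let $[\mathsf{BExt}](\mathsf{Gp})$ be the category whose objects are crossed extensions and whose arrows are isomorphism classes of butterflies between the underlying crossed modules. Let $Q\colon\mathsf{XExt}(\mathsf{Gp})\to[\mathsf{BExt}](\mathsf{Gp})$ be the functor which is the identity on objects and sends $(f_1,f_2)\colon\partial_H\to\partial_G$ to the class of the butterfly $E=G_2\rtimes H_1$ (with $H_1$ acting on $G_2$ via $f_1$), $\kappa(x)=(f_2(x)^{-1},\partial_H x)$, $\iota(y)=(y,1)$,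 $\delta(y,h)=h$, $\gamma(y,h)=\partial_G(y)f_1(h)$. A functor $P\colon\mathsf X\to\mathsf M$ together with fibrations $F\colon\mathsf X\to\mathsf B$, $G\colon\mathsf M\to\mathsf B$ is fibred over $\mathsf B$ if $G\cdot P=F$ and $P$ sends $F$-cartesian morphisms to $G$-cartesian morphisms; it is a fibrewise opfibration over $\mathsf B$ if moreover for each object $b$ of $\mathsf B$ the restriction $P_b\colon\mathsf X_b\to\mathsf M_b$ to the fibres is an opfibration. **Statement.** The functor $Q$ presents $[\mathsf{BExt}](\mathsf{Gp})$ as the category of fractions of $\mathsf{XExt}(\mathsf{Gp})$ with respect to weak equivalences: $Q$ sends weak equivalences to isomorphisms, and every functor $F\colon\mathsf{XExt}(\mathsf{Gp})\to\mathsf D$ to any category $\mathsf D$ which sends weak equivalences to isomorphisms factors as $F=\widetilde F\cdot Q$ for a unique functor $\widetilde F\colon[\mathsf{BExt}](\mathsf{Gp})\to\mathsf D$. Moreover, $(\Pi,\Pi_0,(\ )_0)$ is a fibrewise opfibration over $\mathsf{Gp}$, and there is a functor $P\colon[\mathsf{BExt}](\mathsf{Gp})\to\mathsf{Mod}(\mathsf{Gp})$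 with $\Pi=P\cdot Q$ such that, with $P_0=(\ )_0\cdot P$, the functor $Q$ is fibred over $\mathsf{Gp}$ from $\Pi_0$ to $P_0$, the triple $(P,P_0,(\ )_0)$ is a fibrewise opfibration over $\mathsf{Gp}$, and every fibre of $P$ is a groupoid. -/

import Mathlib

open CategoryTheory

universe u v₁ v₂ v₃ w₁ w₂ w₃

/-! ### Fibrewise opfibrations -/

/-- The functor `p` is an opfibration: every `f : p x ⟶ S` has an opcartesian lifting at `x`, where
opcartesian means having the universal property against morphisms over all `f ≫ g`. -/
def IsOpfibration {X : Type w₁} {B : Type w₂} [Category.{v₁} X] [Category.{v₂} B]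
    (p : X ⥤ B) : Prop :=
  ∀ (x : X) (S : B) (f : p.obj x ⟶ S), ∃ (y : X) (φ : x ⟶ y), p.IsStronglyCocartesian f φ

/-- `P` is a morphism `(X, F) ⟶ (M, G)` in the category of fibrations over `B`: the functors
`F : X ⥤ B` and `G : M ⥤ B` are fibrations, `G ∘ P = F`, and `P` sends `F`-cartesian morphisms to
`G`-cartesian morphisms. -/
structure IsFibredFunctor {X : Type w₁} {M : Type w₂} {B : Type w₃} [Category.{v₁} X]
    [Category.{v₂} M] [Category.{v₃} B] (P : X ⥤ M) (F : X ⥤ B) (G : M ⥤ B) : Prop where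
  isFibered_left : F.IsFibered
  isFibered_right : G.IsFibered
  comp_eq : P ⋙ G = F
  map_cartesian : ∀ {x y : X} (f : x ⟶ y), F.IsStronglyCartesian (F.map f) f →
    G.IsStronglyCartesian (G.map (P.map f)) (P.map f)

/-- The restriction `P_b : X_b ⥤ M_b` of a functor `P` over `B` to the fibres over `b`. -/
def fibreRestriction {X : Type w₁} {M : Type w₂} {B : Type w₃} [Category.{v₁} X]
    [Category.{v₂} M] [Category.{v₃} B] {P : X ⥤ M} {F : X ⥤ B} {G : M ⥤ B}
    (h : P ⋙ G = F) (b : B) : F.Fiber b ⥤ G.Fiber b :=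
  Functor.Fiber.inducedFunctor (F := Functor.Fiber.fiberInclusion ⋙ P) (by
    rw [Functor.assoc, h]
    exact Functor.Fiber.fiberInclusion_comp_eq_const)

/-- A fibrewise opfibration: a morphism of fibrations over `B` whose restriction to each fibre
is an opfibration. -/
structure IsFibrewiseOpfibration {X : Type w₁} {M : Type w₂} {B : Type w₃} [Category.{v₁} X]
    [Category.{v₂} M] [Category.{v₃} B] (P : X ⥤ M) (F : X ⥤ B) (G : M ⥤ B) : Prop
    extends IsFibredFunctor P F G where
  opfibration_fibre : ∀ b : B, IsOpfibration (fibreRestriction comp_eq b)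

/-! ### Crossed modules and crossed extensions -/

/-- A crossed module of groups `bd : G₂ → G₁` (all groups are written multiplicatively). -/
structure CrossedModule where
  G₂ : Type u
  G₁ : Type u
  [group₂ : Group G₂]
  [group₁ : Group G₁]
  [action : MulDistribMulAction G₁ G₂]
  bd : G₂ →* G₁
  bd_smul : ∀ (g : G₁) (x : G₂), bd (g • x) = g * bd x * g⁻¹
  peiffer : ∀ x y : G₂, bd x • y = x * y * x⁻¹

attribute [instance] CrossedModule.group₂ CrossedModule.group₁ CrossedModule.action

/-- A morphism of crossed modules. -/
@[ext]
structure CrossedModule.Hom (H G : CrossedModule.{u}) where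
  f₂ : H.G₂ →* G.G₂
  f₁ : H.G₁ →* G.G₁
  comm : ∀ x, G.bd (f₂ x) = f₁ (H.bd x)
  equivariant : ∀ (g : H.G₁) (x : H.G₂), f₂ (g • x) = f₁ g • f₂ x

/-- A crossed extension: an exact sequence `1 → B → G₂ → G₁ → C → 1` of groups whose middle
map is a crossed module. -/
structure CrossedExtension extends CrossedModule.{u} where
  B : Type u
  C : Type u
  [groupB : Group B]
  [groupC : Group C]
  j : B →* G₂
  p : G₁ →* C
  j_injective : Function.Injective j
  exact₂ : j.range = bd.ker
  exact₁ : bd.range = p.ker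
  p_surjective : Function.Surjective p

attribute [instance] CrossedExtension.groupB CrossedExtension.groupC

/-- A morphism of crossed extensions: a morphism of exact sequences whose middle part is a
morphism of crossed modules. -/
@[ext]
structure CrossedExtension.Hom (X Y : CrossedExtension.{u}) extends
    CrossedModule.Hom X.toCrossedModule Y.toCrossedModule where
  β : X.B →* Y.B
  γ : X.C →* Y.C
  comm_j : ∀ b, Y.j (β b) = f₂ (X.j b)
  comm_p : ∀ g, Y.p (f₁ g) = γ (X.p g)

/-- The category `XExt(Gp)` of crossed extensions of groups. -/
instance : Category CrossedExtension.{u} where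
  Hom := CrossedExtension.Hom
  id X :=
    { f₂ := MonoidHom.id _, f₁ := MonoidHom.id _, β := MonoidHom.id _, γ := MonoidHom.id _
      comm := fun _ => rfl, equivariant := fun _ _ => rfl
      comm_j := fun _ => rfl, comm_p := fun _ => rfl }
  comp f g :=
    { f₂ := g.f₂.comp f.f₂, f₁ := g.f₁.comp f.f₁, β := g.β.comp f.β, γ := g.γ.comp f.γ
      comm := fun x => by simp [g.comm, f.comm]
      equivariant := fun a x => by simp [g.equivariant, f.equivariant]
      comm_j := fun b => by simp [g.comm_j, f.comm_j]
      comm_p := fun a => by simp [g.comm_p, f.comm_p] }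
  id_comp _ := rfl
  comp_id _ := rfl
  assoc _ _ _ := rfl

/-! ### Group modules -/

/-- A group module: a group `C` with a `C`-module `B` (an abelian group, written multiplicatively,
on which `C` acts by automorphisms). -/
structure GroupModule where
  C : Type u
  B : Type u
  [groupC : Group C]
  [commGroupB : CommGroup B]
  [action : MulDistribMulAction C B]

attribute [instance] GroupModule.groupC GroupModule.commGroupB GroupModule.action

/-- An equivariant pair of homomorphisms. -/
@[ext]
structure GroupModule.Hom (M N : GroupModule.{u}) where
  γ : M.C →* N.C
  β : M.B →* N.B
  equivariant : ∀ (c : M.C) (b : M.B), β (c • b) = γ c • β b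

/-- The category `Mod(Gp)` of group modules. -/
instance : Category GroupModule.{u} where
  Hom := GroupModule.Hom
  id M := ⟨MonoidHom.id _, MonoidHom.id _, fun _ _ => rfl⟩
  comp f g := ⟨g.γ.comp f.γ, g.β.comp f.β, fun c b => by simp [g.equivariant, f.equivariant]⟩
  id_comp _ := rfl
  comp_id _ := rfl
  assoc _ _ _ := rfl

/-- The forgetful functor `( )₀ : Mod(Gp) ⥤ Gp`, sending a `C`-module to its acting group `C`. -/
def GroupModule.actingGroup : GroupModule.{u} ⥤ GrpCat.{u} where
  obj M := GrpCat.of M.C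
  map f := GrpCat.ofHom f.γ

/-! ### The functor `Π` and weak equivalences -/

namespace CrossedExtension

variable (X : CrossedExtension.{u})

theorem bd_j (b : X.B) : X.bd (X.j b) = 1 := by
  have : X.j b ∈ X.bd.ker := X.exact₂ ▸ ⟨b, rfl⟩
  exact this

theorem p_bd (x : X.G₂) : X.p (X.bd x) = 1 := by
  have : X.bd x ∈ X.p.ker := X.exact₁ ▸ ⟨x, rfl⟩
  exact this

theorem exists_j {x : X.G₂} (hx : X.bd x = 1) : ∃ b, X.j b = x := by
  have : x ∈ X.j.range := X.exact₂ ▸ hx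
  exact this

theorem exists_bd {g : X.G₁} (hg : X.p g = 1) : ∃ x, X.bd x = g := by
  have : g ∈ X.bd.range := X.exact₁ ▸ hg
  exact this

theorem exists_act (c : X.C) (b : X.B) :
    ∃ b' : X.B, ∀ g : X.G₁, X.p g = c → X.j b' = g • X.j b := by
  obtain ⟨g₀, hg₀⟩ := X.p_surjective c
  obtain ⟨b', hb'⟩ := X.exists_j (x := g₀ • X.j b) (by rw [X.bd_smul, X.bd_j]; simp)
  refine ⟨b', fun g hg => ?_⟩
  obtain ⟨x, hx⟩ := X.exists_bd (g := g₀⁻¹ * g) (by rw [map_mul, map_inv, hg, hg₀]; simp)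
  have hgx : g = g₀ * X.bd x := by rw [hx]; simp
  have hxy : X.bd x • X.j b = X.j b := by
    have h := X.peiffer (X.j b) x
    rw [X.bd_j, one_smul] at h
    rw [X.peiffer, mul_inv_eq_iff_eq_mul]
    exact eq_mul_inv_iff_mul_eq.mp h
  rw [hb', hgx, mul_smul, hxy]

/-- The kernel `B` of a crossed module is abelian. -/
abbrev commGroupB : CommGroup X.B :=
  { X.groupB with
    mul_comm := fun a b => X.j_injective (by
      have h := X.peiffer (X.j a) (X.j b)
      rw [X.bd_j, one_smul] at h
      rw [map_mul, map_mul]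
      exact (eq_mul_inv_iff_mul_eq.mp h).symm) }

/-- The action of `C` on `B` induced by the one of `G₁` on `G₂`: `c • b` is the element with
`j (c • b) = g • j b` for every `g` with `p g = c`. -/
noncomputable instance : SMul X.C X.B := ⟨fun c b => (X.exists_act c b).choose⟩

theorem j_smul (g : X.G₁) (b : X.B) : X.j (X.p g • b) = g • X.j b :=
  (X.exists_act (X.p g) b).choose_spec g rfl

noncomputable instance : MulDistribMulAction X.C X.B where
  one_smul b := X.j_injective (by rw [← map_one X.p, X.j_smul, one_smul])
  mul_smul c d b := by
    obtain ⟨g, rfl⟩ := X.p_surjective c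
    obtain ⟨h, rfl⟩ := X.p_surjective d
    exact X.j_injective (by rw [← map_mul, X.j_smul, X.j_smul, X.j_smul, mul_smul])
  smul_mul c a b := by
    obtain ⟨g, rfl⟩ := X.p_surjective c
    exact X.j_injective (by simp only [map_mul, X.j_smul, smul_mul'])
  smul_one c := by
    obtain ⟨g, rfl⟩ := X.p_surjective c
    exact X.j_injective (by simp only [map_one, X.j_smul, smul_one])

theorem Hom.map_smul {X Y : CrossedExtension.{u}} (f : Hom X Y) (c : X.C) (b : X.B) :
    f.β (c • b) = f.γ c • f.β b := by
  obtain ⟨g, rfl⟩ := X.p_surjective c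
  refine Y.j_injective ?_
  rw [f.comm_j, X.j_smul, f.equivariant, ← f.comm_p, Y.j_smul, f.comm_j]

/-- The group module `(C, B)` of a crossed extension. -/
noncomputable def module : GroupModule.{u} :=
  letI := X.commGroupB
  { C := X.C, B := X.B }

/-- The functor `Π : XExt(Gp) ⥤ Mod(Gp)`. -/
noncomputable def piFunctor : CrossedExtension.{u} ⥤ GroupModule.{u} where
  obj X := X.module
  map {X Y} f :=
    { γ := f.γ
      β := f.β
      equivariant := Hom.map_smul f }

/-- The functor `Π₀ : XExt(Gp) ⥤ Gp`, sending a crossed extension to its cokernel `C`. -/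
def piZero : CrossedExtension.{u} ⥤ GrpCat.{u} where
  obj X := GrpCat.of X.C
  map f := GrpCat.ofHom f.γ

/-- Weak equivalences of crossed extensions: the morphisms inverted by `Π`. -/
def weakEquivalences : MorphismProperty CrossedExtension.{u} :=
  fun _ _ f => IsIso (piFunctor.map f)

end CrossedExtension

/-! ### Butterflies -/

/-- A butterfly from `H` to `G`:
`κ : H₂ → E`, `ι : G₂ → E`, `δ : E → H₁`, `γ : E → G₁` with `δ κ = ∂`, `γ ι = ∂`, `γ κ = 1`, such
that `1 → G₂ → E → H₁ → 1` is exact, and `κ` and `ι` are pre-crossed modules for the actions of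
`E` on `H₂` via `δ` and on `G₂` via `γ`. -/
structure Butterfly (H G : CrossedModule.{u}) where
  E : Type u
  [group : Group E]
  κ : H.G₂ →* E
  ι : G.G₂ →* E
  δ : E →* H.G₁
  γ : E →* G.G₁
  δ_κ : ∀ x, δ (κ x) = H.bd x
  γ_ι : ∀ y, γ (ι y) = G.bd y
  γ_κ : ∀ x, γ (κ x) = 1
  ι_injective : Function.Injective ι
  exact : ι.range = δ.ker
  δ_surjective : Function.Surjective δ
  κ_smul : ∀ (e : E) (x : H.G₂), κ (δ e • x) = e * κ x * e⁻¹
  ι_smul : ∀ (e : E) (y : G.G₂), ι (γ e • y) = e * ι y * e⁻¹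

attribute [instance] Butterfly.group

namespace Butterfly

variable {H G K L : CrossedModule.{u}}

/-- A 2-cell between butterflies. -/
structure Hom (E F : Butterfly H G) where
  α : E.E →* F.E
  α_κ : ∀ x, α (E.κ x) = F.κ x
  α_ι : ∀ y, α (E.ι y) = F.ι y
  δ_α : ∀ e, F.δ (α e) = E.δ e
  γ_α : ∀ e, F.γ (α e) = E.γ e

theorem δ_ι (E : Butterfly H G) (y : G.G₂) : E.δ (E.ι y) = 1 := by
  have : E.ι y ∈ E.δ.ker := E.exact ▸ ⟨y, rfl⟩
  exact this

theorem exists_ι (E : Butterfly H G) {e : E.E} (he : E.δ e = 1) : ∃ y, E.ι y = e := by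
  have : e ∈ E.ι.range := E.exact ▸ he
  exact this

/-- Every 2-cell between butterflies is invertible. -/
theorem Hom.bijective {E F : Butterfly H G} (φ : Hom E F) : Function.Bijective φ.α := by
  constructor
  · rw [injective_iff_map_eq_one]
    intro e he
    have h1 : E.δ e = 1 := by rw [← φ.δ_α, he, map_one]
    obtain ⟨y, rfl⟩ := E.exists_ι h1
    rw [φ.α_ι] at he
    rw [F.ι_injective (he.trans (map_one F.ι).symm), map_one]
  · intro f
    obtain ⟨e, he⟩ := E.δ_surjective (F.δ f)
    obtain ⟨y, hy⟩ := F.exists_ι (e := (φ.α e)⁻¹ * f) (by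
      rw [map_mul, map_inv, φ.δ_α, he]; simp)
    exact ⟨e * E.ι y, by rw [map_mul, φ.α_ι, hy]; simp⟩

/-- Two butterflies are isomorphic: there is an isomorphism of groups which is a 2-cell. -/
def Isomorphic (E F : Butterfly H G) : Prop :=
  ∃ φ : Hom E F, Function.Bijective φ.α

theorem Hom.isomorphic {E F : Butterfly H G} (φ : Hom E F) : Isomorphic E F :=
  ⟨φ, φ.bijective⟩

theorem Isomorphic.symm {E F : Butterfly H G} : Isomorphic E F → Isomorphic F E := by
  rintro ⟨φ, hφ⟩
  let e := MulEquiv.ofBijective φ.α hφ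
  have h : ∀ x, φ.α (e.symm x) = x := e.apply_symm_apply
  have h' : ∀ x, e.symm (φ.α x) = x := e.symm_apply_apply
  exact Hom.isomorphic
    { α := e.symm.toMonoidHom
      α_κ := fun x => by
        rw [← φ.α_κ]
        exact h' _
      α_ι := fun x => by
        rw [← φ.α_ι]
        exact h' _
      δ_α := fun x => by
        rw [← φ.δ_α]
        exact congrArg F.δ (h x)
      γ_α := fun x => by
        rw [← φ.γ_α]
        exact congrArg F.γ (h x) }

/-- Isomorphism of butterflies as an equivalence relation. -/
instance setoid (H G : CrossedModule.{u}) : Setoid (Butterfly H G) where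
  r := Isomorphic
  iseqv :=
    { refl := fun _ => Hom.isomorphic
        { α := MonoidHom.id _, α_κ := fun _ => rfl, α_ι := fun _ => rfl
          δ_α := fun _ => rfl, γ_α := fun _ => rfl }
      symm := Isomorphic.symm
      trans := by
        rintro _ _ _ ⟨φ, -⟩ ⟨ψ, -⟩
        exact Hom.isomorphic
          { α := ψ.α.comp φ.α
            α_κ := fun x => by simp [φ.α_κ, ψ.α_κ]
            α_ι := fun x => by simp [φ.α_ι, ψ.α_ι]
            δ_α := fun x => by simp [φ.δ_α, ψ.δ_α]
            γ_α := fun x => by simp [φ.γ_α, ψ.γ_α] } }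

/-! #### Composition -/

/-- The pullback `E ×_{G₁} E'` of `γ : E → G₁` and `δ' : E' → G₁`. -/
def pullback (E : Butterfly H G) (E' : Butterfly G K) : Subgroup (E.E × E'.E) :=
  MonoidHom.eqLocus (E.γ.comp (MonoidHom.fst _ _)) (E'.δ.comp (MonoidHom.snd _ _))

/-- The homomorphism `⟨ι, κ'⟩ : G₂ → E ×_{G₁} E'`. -/
def diag (E : Butterfly H G) (E' : Butterfly G K) : G.G₂ →* pullback E E' :=
  (E.ι.prod E'.κ).codRestrict (pullback E E') (fun y => by
    change E.γ (E.ι y) = E'.δ (E'.κ y)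
    rw [E.γ_ι, E'.δ_κ])

instance (E : Butterfly H G) (E' : Butterfly G K) : (diag E E').range.Normal where
  conj_mem := by
    rintro _ ⟨y, rfl⟩ ⟨⟨e, e'⟩, he⟩
    refine ⟨E.γ e • y, Subtype.ext (Prod.ext ?_ ?_)⟩
    · exact E.ι_smul e y
    · have he' : E.γ e = E'.δ e' := he
      change E'.κ (E.γ e • y) = e' * E'.κ y * e'⁻¹
      rw [he', E'.κ_smul]

/-- The group `(E ×_{G₁} E') / G₂` of the composite butterfly. -/
abbrev CompGroup (E : Butterfly H G) (E' : Butterfly G K) : Type u :=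
  pullback E E' ⧸ (diag E E').range

/-- The class in `(E ×_{G₁} E') / G₂` of a pair. -/
def compMk (E : Butterfly H G) (E' : Butterfly G K) : pullback E E' →* CompGroup E E' :=
  QuotientGroup.mk' _

theorem compMk_surjective (E : Butterfly H G) (E' : Butterfly G K) :
    Function.Surjective (compMk E E') :=
  QuotientGroup.mk'_surjective _

theorem compMk_eq_one {E : Butterfly H G} {E' : Butterfly G K} {x : pullback E E'} :
    compMk E E' x = 1 ↔ ∃ y, E.ι y = x.1.1 ∧ E'.κ y = x.1.2 := by
  refine (QuotientGroup.eq_one_iff x).trans ⟨?_, ?_⟩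
  · rintro ⟨y, rfl⟩
    exact ⟨y, rfl, rfl⟩
  · rintro ⟨y, h1, h2⟩
    exact ⟨y, Subtype.ext (Prod.ext h1 h2)⟩

theorem compMk_eq_iff {E : Butterfly H G} {E' : Butterfly G K} {x z : pullback E E'} :
    compMk E E' x = compMk E E' z ↔
      ∃ y, x.1.1 * E.ι y = z.1.1 ∧ x.1.2 * E'.κ y = z.1.2 := by
  have h : compMk E E' x = compMk E E' z ↔ compMk E E' (x⁻¹ * z) = 1 := by
    rw [map_mul, map_inv, inv_mul_eq_one]
  rw [h, compMk_eq_one]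
  refine exists_congr fun y => and_congr ?_ ?_
  · exact eq_inv_mul_iff_mul_eq
  · exact eq_inv_mul_iff_mul_eq

theorem compMk_eq {E : Butterfly H G} {E' : Butterfly G K} {x z : pullback E E'} (y : G.G₂)
    (h1 : x.1.1 * E.ι y = z.1.1) (h2 : x.1.2 * E'.κ y = z.1.2) :
    compMk E E' x = compMk E E' z :=
  compMk_eq_iff.mpr ⟨y, h1, h2⟩

/-- The composite butterfly `E' · E : H → K` of `E : H → G` and `E' : G → K`, with
`κ''(x) = [κ x, 1]`, `ι''(z) = [1, ι' z]`, `δ''[e, e'] = δ e` and `γ''[e, e'] = γ' e'`. -/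
def comp (E : Butterfly H G) (E' : Butterfly G K) : Butterfly H K where
  E := CompGroup E E'
  κ := (compMk E E').comp (((MonoidHom.inl _ _).comp E.κ).codRestrict (pullback E E') (fun x => by
    change E.γ (E.κ x) = E'.δ 1
    rw [E.γ_κ, map_one]))
  ι := (compMk E E').comp (((MonoidHom.inr _ _).comp E'.ι).codRestrict (pullback E E') (fun z => by
    change E.γ 1 = E'.δ (E'.ι z)
    rw [E'.δ_ι, map_one]))
  δ := QuotientGroup.lift _ ((E.δ.comp (MonoidHom.fst _ _)).comp (pullback E E').subtype) (by
    rintro _ ⟨y, rfl⟩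
    exact E.δ_ι y)
  γ := QuotientGroup.lift _ ((E'.γ.comp (MonoidHom.snd _ _)).comp (pullback E E').subtype) (by
    rintro _ ⟨y, rfl⟩
    exact E'.γ_κ y)
  δ_κ x := E.δ_κ x
  γ_ι z := E'.γ_ι z
  γ_κ x := map_one E'.γ
  ι_injective := by
    rw [injective_iff_map_eq_one]
    intro z hz
    obtain ⟨y, h1, h2⟩ := compMk_eq_one.mp hz
    have h1' : E.ι y = 1 := h1
    have h2' : E'.κ y = E'.ι z := h2
    have hy : y = 1 := E.ι_injective (h1'.trans (map_one _).symm)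
    rw [hy, map_one] at h2'
    exact E'.ι_injective (h2'.symm.trans (map_one _).symm)
  exact := by
    ext q
    constructor
    · rintro ⟨z, rfl⟩
      exact map_one E.δ
    · obtain ⟨⟨⟨e, e'⟩, he⟩, rfl⟩ := compMk_surjective E E' q
      intro hq
      have hq' : E.δ e = 1 := hq
      obtain ⟨y, rfl⟩ := E.exists_ι hq'
      have he' : E.γ (E.ι y) = E'.δ e' := he
      obtain ⟨z, hz⟩ := E'.exists_ι (e := e' * (E'.κ y)⁻¹) (by
        rw [map_mul, map_inv, E'.δ_κ, ← he', E.γ_ι]; simp)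
      refine ⟨z, compMk_eq y ?_ ?_⟩
      · exact one_mul _
      · change E'.ι z * E'.κ y = e'
        rw [hz]; simp
  δ_surjective h := by
    obtain ⟨e, rfl⟩ := E.δ_surjective h
    obtain ⟨e', he'⟩ := E'.δ_surjective (E.γ e)
    exact ⟨compMk E E' ⟨(e, e'), he'.symm⟩, rfl⟩
  κ_smul q x := by
    obtain ⟨⟨⟨e, e'⟩, he⟩, rfl⟩ := compMk_surjective E E' q
    refine congrArg (compMk E E') (Subtype.ext (Prod.ext (E.κ_smul e x) ?_))
    change 1 = e' * 1 * e'⁻¹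
    simp
  ι_smul q z := by
    obtain ⟨⟨⟨e, e'⟩, he⟩, rfl⟩ := compMk_surjective E E' q
    refine congrArg (compMk E E') (Subtype.ext (Prod.ext ?_ (E'.ι_smul e' z)))
    change 1 = e * 1 * e⁻¹
    simp

/-- Composition of 2-cells. -/
theorem comp_congr {E F : Butterfly H G} {E' F' : Butterfly G K} (h : Isomorphic E F)
    (h' : Isomorphic E' F') : Isomorphic (comp E E') (comp F F') := by
  obtain ⟨φ, -⟩ := h
  obtain ⟨ψ, -⟩ := h'
  let θ : pullback E E' →* pullback F F' :=
    ((φ.α.prodMap ψ.α).comp (pullback E E').subtype).codRestrict (pullback F F') (by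
      rintro ⟨⟨e, e'⟩, he⟩
      change F.γ (φ.α e) = F'.δ (ψ.α e')
      rw [φ.γ_α, ψ.δ_α]
      exact he)
  exact Hom.isomorphic
    { α := QuotientGroup.lift _ ((compMk F F').comp θ) (by
        rintro _ ⟨y, rfl⟩
        exact compMk_eq_one.mpr ⟨y, (φ.α_ι y).symm, (ψ.α_κ y).symm⟩)
      α_κ := fun x => congrArg (compMk F F')
        (Subtype.ext (Prod.ext (φ.α_κ x) (map_one ψ.α)))
      α_ι := fun z => congrArg (compMk F F')
        (Subtype.ext (Prod.ext (map_one φ.α) (ψ.α_ι z)))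
      δ_α := fun q => by
        obtain ⟨⟨⟨e, e'⟩, he⟩, rfl⟩ := compMk_surjective E E' q
        exact φ.δ_α e
      γ_α := fun q => by
        obtain ⟨⟨⟨e, e'⟩, he⟩, rfl⟩ := compMk_surjective E E' q
        exact ψ.γ_α e' }

/-- Composition of butterflies is associative up to isomorphism. -/
theorem comp_assoc (E : Butterfly H G) (E' : Butterfly G K) (E'' : Butterfly K L) :
    Isomorphic (comp (comp E E') E'') (comp E (comp E' E'')) := by
  -- the group of triples and its two projections
  let T : Subgroup (E.E × E'.E × E''.E) :=
    { carrier := {t | E.γ t.1 = E'.δ t.2.1 ∧ E'.γ t.2.1 = E''.δ t.2.2}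
      mul_mem' := by
        rintro a b ⟨h1, h2⟩ ⟨h3, h4⟩
        exact ⟨by simp [h1, h3], by simp [h2, h4]⟩
      one_mem' := by simp
      inv_mem' := by
        rintro a ⟨h1, h2⟩
        exact ⟨by simp [h1], by simp [h2]⟩ }
  let a : T →* pullback E E' :=
    { toFun := fun t => ⟨(t.1.1, t.1.2.1), t.2.1⟩, map_one' := rfl, map_mul' := fun _ _ => rfl }
  let b : T →* pullback E' E'' :=
    { toFun := fun t => ⟨(t.1.2.1, t.1.2.2), t.2.2⟩, map_one' := rfl, map_mul' := fun _ _ => rfl }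
  let l : T →* pullback (comp E E') E'' :=
    { toFun := fun t => ⟨(compMk E E' (a t), t.1.2.2), t.2.2⟩
      map_one' := rfl, map_mul' := fun _ _ => rfl }
  let r : T →* pullback E (comp E' E'') :=
    { toFun := fun t => ⟨(t.1.1, compMk E' E'' (b t)), t.2.1⟩
      map_one' := rfl, map_mul' := fun _ _ => rfl }
  let l' : T →* (comp (comp E E') E'').E := (compMk _ _).comp l
  let r' : T →* (comp E (comp E' E'')).E := (compMk _ _).comp r
  have hl : Function.Surjective l' := by
    intro q
    obtain ⟨⟨⟨s, e''⟩, hs⟩, rfl⟩ := compMk_surjective _ _ q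
    obtain ⟨⟨⟨e, e'⟩, he⟩, rfl⟩ := compMk_surjective E E' s
    exact ⟨⟨(e, e', e''), he, hs⟩, rfl⟩
  have hlr : l'.ker ≤ r'.ker := by
    rintro ⟨⟨e, e', e''⟩, ht⟩ h
    obtain ⟨z, h1, h2⟩ := compMk_eq_one.mp (MonoidHom.mem_ker.mp h)
    obtain ⟨w, h3, h4⟩ := compMk_eq_iff.mp
      (show compMk E E' ⟨(1, E'.ι z), _⟩ = compMk E E' ⟨(e, e'), ht.1⟩ from h1)
    have h3' : 1 * E.ι w = e := h3
    have h4' : E'.ι z * E'.κ w = e' := h4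
    have hc : E'.ι z * E'.κ w = E'.κ w * E'.ι z := by
      have := E'.ι_smul (E'.κ w) z
      rw [E'.γ_κ, one_smul] at this
      exact eq_mul_inv_iff_mul_eq.mp this
    refine MonoidHom.mem_ker.mpr (compMk_eq_one.mpr ⟨w, (one_mul _).symm.trans h3', ?_⟩)
    refine compMk_eq z ?_ ?_
    · exact hc.symm.trans h4'
    · exact (one_mul _).trans h2
  have hα : ∀ t, l'.liftOfSurjective hl ⟨r', hlr⟩ (l' t) = r' t :=
    fun t => MonoidHom.liftOfRightInverse_comp_apply _ _ _ _ t
  exact Hom.isomorphic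
    { α := l'.liftOfSurjective hl ⟨r', hlr⟩
      α_κ := fun x => hα ⟨(E.κ x, 1, 1), by simp [E.γ_κ], by simp⟩
      α_ι := fun z => hα ⟨(1, 1, E''.ι z), by simp, by simp [E''.δ_ι]⟩
      δ_α := fun q => by
        obtain ⟨t, rfl⟩ := hl q
        rw [hα]
        rfl
      γ_α := fun q => by
        obtain ⟨t, rfl⟩ := hl q
        rw [hα]
        rfl }

/-! #### Representable butterflies -/

/-- The action of `H₁` on `G₂` via `f₁`. -/
def homAction (f : CrossedModule.Hom H G) : H.G₁ →* MulAut G.G₂ :=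
  (MulDistribMulAction.toMulAut G.G₁ G.G₂).comp f.f₁

/-- The butterfly of a morphism `f = (f₁, f₂) : H → G` of crossed modules. Its group is the pullback
along `f₁ : H₁ → G₁` of the domain map `G₂ ⋊ G₁ → G₁` of the groupoid of `G`, that is `G₂ ⋊ H₁`,
where `H₁` acts via `f₁`. As the codomain map of the groupoid sends `(y, g)` to `∂ y * g`
and inversion sends `(y, 1)` to `(y⁻¹, ∂ y)`, one has `κ x = (f₂ x⁻¹, ∂ x)`, `ι y = (y, 1)`,
`δ (y, h) = h` and `γ (y, h) = ∂ y * f₁ h`. -/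
def ofHom (f : CrossedModule.Hom H G) : Butterfly H G where
  E := G.G₂ ⋊[homAction f] H.G₁
  κ :=
    { toFun := fun x => ⟨(f.f₂ x)⁻¹, H.bd x⟩
      map_one' := by ext <;> simp
      map_mul' := fun x y => by
        refine SemidirectProduct.ext ?_ (map_mul H.bd x y)
        change (f.f₂ (x * y))⁻¹ = (f.f₂ x)⁻¹ * f.f₁ (H.bd x) • (f.f₂ y)⁻¹
        rw [← f.comm, G.peiffer, map_mul]
        group }
  ι := SemidirectProduct.inl
  δ := SemidirectProduct.rightHom
  γ :=
    { toFun := fun e => G.bd e.left * f.f₁ e.right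
      map_one' := by simp
      map_mul' := fun a b => by
        change G.bd (a.left * f.f₁ a.right • b.left) * f.f₁ (a.right * b.right) = _
        rw [map_mul, map_mul, G.bd_smul]
        group }
  δ_κ _ := rfl
  γ_ι y := by simp
  γ_κ x := by simp [f.comm]
  ι_injective := SemidirectProduct.inl_injective
  exact := SemidirectProduct.range_inl_eq_ker_rightHom
  δ_surjective := SemidirectProduct.rightHom_surjective
  κ_smul e x := by
    rw [eq_mul_inv_iff_mul_eq]
    refine SemidirectProduct.ext ?_ ?_
    · change (f.f₂ (e.right • x))⁻¹ * f.f₁ (H.bd (e.right • x)) • e.left =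
        e.left * f.f₁ e.right • (f.f₂ x)⁻¹
      rw [← f.comm, G.peiffer, f.equivariant, smul_inv']
      group
    · change H.bd (e.right • x) * e.right = e.right * H.bd x
      rw [H.bd_smul]
      group
  ι_smul e y := by
    rw [eq_mul_inv_iff_mul_eq]
    refine SemidirectProduct.ext ?_ ?_
    · change (G.bd e.left * f.f₁ e.right) • y * f.f₁ 1 • e.left = e.left * f.f₁ e.right • y
      rw [mul_smul, G.peiffer, map_one, one_smul]
      group
    · exact (one_mul _).trans (mul_one _).symm

/-- The identity butterfly. -/
def id (H : CrossedModule.{u}) : Butterfly H H :=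
  ofHom ⟨MonoidHom.id _, MonoidHom.id _, fun _ => rfl, fun _ _ => rfl⟩

theorem id_comp (E : Butterfly H G) : Isomorphic (comp (id H) E) E :=
  Isomorphic.symm <| Hom.isomorphic
    { α := (compMk (id H) E).comp
        { toFun := fun e => ⟨(⟨1, E.δ e⟩, e), by
            change H.bd 1 * E.δ e = E.δ e
            simp⟩
          map_one' := Subtype.ext (Prod.ext (SemidirectProduct.ext rfl (map_one E.δ)) rfl)
          map_mul' := fun a b => Subtype.ext (Prod.ext (by
            refine SemidirectProduct.ext ?_ ?_
            · exact (by simp : (1 : H.G₂) = 1 * (E.δ a • 1))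
            · exact map_mul E.δ a b) rfl) }
      α_κ := fun x => (compMk_eq x (by
        refine SemidirectProduct.ext ?_ ?_
        · change x⁻¹ * (H.bd x • x) = 1
          simp [H.peiffer]
        · change H.bd x * 1 = E.δ (E.κ x)
          rw [E.δ_κ, mul_one]) (one_mul _)).symm
      α_ι := fun y => congrArg (compMk (id H) E) (Subtype.ext (Prod.ext (by
        refine SemidirectProduct.ext rfl ?_
        exact E.δ_ι y) rfl))
      δ_α := fun e => rfl
      γ_α := fun e => rfl }

theorem comp_id (E : Butterfly H G) : Isomorphic (comp E (id G)) E :=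
  Isomorphic.symm <| Hom.isomorphic
    { α := (compMk E (id G)).comp
        { toFun := fun e => ⟨(e, ⟨1, E.γ e⟩), rfl⟩
          map_one' := Subtype.ext (Prod.ext rfl (SemidirectProduct.ext rfl (map_one E.γ)))
          map_mul' := fun a b => Subtype.ext (Prod.ext rfl (by
            refine SemidirectProduct.ext ?_ ?_
            · exact (by simp : (1 : G.G₂) = 1 * (E.γ a • 1))
            · exact map_mul E.γ a b)) }
      α_κ := fun x => congrArg (compMk E (id G)) (Subtype.ext (Prod.ext rfl (by
        refine SemidirectProduct.ext rfl ?_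
        exact E.γ_κ x)))
      α_ι := fun y => (compMk_eq y (one_mul _) (by
        refine SemidirectProduct.ext ?_ ?_
        · change y * ((1 : G.G₁) • y⁻¹) = 1
          simp
        · change 1 * G.bd y = E.γ (E.ι y)
          rw [E.γ_ι, one_mul])).symm
      δ_α := fun e => rfl
      γ_α := fun e => by
        change G.bd 1 * E.γ e = E.γ e
        simp }

theorem ofHom_comp (f : CrossedModule.Hom H G) (g : CrossedModule.Hom G K)
    (gf : CrossedModule.Hom H K) (h₁ : gf.f₁ = g.f₁.comp f.f₁) (h₂ : gf.f₂ = g.f₂.comp f.f₂) :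
    Isomorphic (ofHom gf) (comp (ofHom f) (ofHom g)) := by
  have h₁' : ∀ x, gf.f₁ x = g.f₁ (f.f₁ x) := fun x => by rw [h₁]; rfl
  have h₂' : ∀ x, gf.f₂ x = g.f₂ (f.f₂ x) := fun x => by rw [h₂]; rfl
  exact Hom.isomorphic
    { α := (compMk (ofHom f) (ofHom g)).comp
        { toFun := fun e => ⟨(⟨1, e.right⟩, ⟨e.left, f.f₁ e.right⟩), by
            change G.bd 1 * f.f₁ e.right = f.f₁ e.right
            simp⟩
          map_one' := Subtype.ext (Prod.ext rfl (SemidirectProduct.ext rfl (map_one f.f₁)))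
          map_mul' := fun a b => Subtype.ext (Prod.ext (by
            refine SemidirectProduct.ext ?_ rfl
            exact (by simp : (1 : G.G₂) = 1 * (f.f₁ a.right • 1))) (by
            refine SemidirectProduct.ext ?_ (map_mul f.f₁ _ _)
            change a.left * (gf.f₁ a.right • b.left) = a.left * (g.f₁ (f.f₁ a.right) • b.left)
            rw [h₁'])) }
      α_κ := fun x => (compMk_eq (f.f₂ x) (by
        refine SemidirectProduct.ext ?_ ?_
        · change (f.f₂ x)⁻¹ * (f.f₁ (H.bd x) • f.f₂ x) = 1
          simp [← f.comm, G.peiffer]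
        · exact mul_one (H.bd x)) (by
        refine (one_mul _).trans (SemidirectProduct.ext ?_ (f.comm x))
        change (g.f₂ (f.f₂ x))⁻¹ = (gf.f₂ x)⁻¹
        rw [h₂'])).symm
      α_ι := fun y => congrArg (compMk (ofHom f) (ofHom g)) (Subtype.ext (Prod.ext rfl (by
        exact SemidirectProduct.ext rfl (map_one f.f₁))))
      δ_α := fun e => rfl
      γ_α := fun e => by
        change K.bd e.left * g.f₁ (f.f₁ e.right) = K.bd e.left * gf.f₁ e.right
        rw [h₁'] }

end Butterfly

/-! ### The category of crossed extensions and classes of butterflies -/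

/-- Objects of `[BExt](Gp)`: crossed extensions. -/
def BExt : Type (u + 1) := CrossedExtension.{u}

/-- The category `[BExt](Gp)`: morphisms are isomorphism classes of butterflies between
the underlying crossed modules. -/
instance : Category.{u + 1} BExt.{u} where
  Hom X Y := Quotient (Butterfly.setoid (CrossedExtension.toCrossedModule X)
    (CrossedExtension.toCrossedModule Y))
  id X := Quotient.mk _ (Butterfly.id (CrossedExtension.toCrossedModule X))
  comp := Quotient.map₂ Butterfly.comp (fun _ _ h _ _ h' => Butterfly.comp_congr h h')
  id_comp := by
    rintro X Y ⟨E⟩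
    exact Quotient.sound (Butterfly.id_comp E)
  comp_id := by
    rintro X Y ⟨E⟩
    exact Quotient.sound (Butterfly.comp_id E)
  assoc := by
    rintro X Y Z W ⟨E⟩ ⟨E'⟩ ⟨E''⟩
    exact Quotient.sound (Butterfly.comp_assoc E E' E'')

/-- The functor `Q : XExt(Gp) ⥤ [BExt](Gp)`, the identity on objects, sending a morphism of
crossed extensions to the class of the butterfly of its underlying morphism of crossed modules. -/
def Q : CrossedExtension.{u} ⥤ BExt.{u} where
  obj X := X
  map f := Quotient.mk _ (Butterfly.ofHom (CrossedExtension.Hom.toHom f))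
  map_id _ := rfl
  map_comp _ _ := Quotient.sound (Butterfly.ofHom_comp _ _ _ rfl rfl)

/-! ### Fibrations and opfibrations -/

section Fibrations

variable {X : Type w₁} {M : Type w₂} {B : Type w₃} [Category.{v₁} X] [Category.{v₂} M]
  [Category.{v₃} B]

/-! A butterfly `E` is a fraction. Its wings assemble into a crossed module `H₂ × G₂ → E`, `(x, y) ↦
κ x * ι y`, with projections to `H` and `G`. Exactness of `G₂ → E → H₁` says that the left
projection is pulled back along the surjection `δ`, so it preserves kernel and cokernel: it is a
weak equivalence. Moreover `Q(left) ≫ [E] = Q(right)` (`BExt.Q_left_comp`).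

`Q` inverts weak equivalences because, when `f` is bijective on `B` and `C`, the other diagonal of
its butterfly is an extension too, and the butterfly read backwards is an inverse
(`isFlippable_ofHom`, `isIso_homMk`). Hence `[E] = Q(left)⁻¹ Q(right)`, which forces the value
`F(left)⁻¹ F(right)` on `[E]` (`functor_ext`); that this formula defines a functor is
`liftMap_congr`, `liftMap_ofHom` and `liftMap_comp`.

`P` is the functor induced in this way by `Π`. If it inverts `[E]`, then the right leg of the span
is also a weak equivalence, so `[E]` is invertible. Thus `P` reflects isomorphisms and its fibres
are groupoids.

Cartesian lifts replace `G₁` by `G₁ ×_C R`; opcartesian lifts over maps invertible on `C` replace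
`G₂` by `G₂ ⊕_B B'`. The same lifts work before and after `Q`: a butterfly into the base change, or
out of the pushout, keeps its group and alters only `γ`, respectively only `κ`. -/

theorem isStronglyCartesian_map (p : X ⥤ B) {a b : X} (φ : a ⟶ b)
    (h : ∀ (a' : X) (g : p.obj a' ⟶ p.obj a) (φ' : a' ⟶ b), p.map φ' = g ≫ p.map φ →
      ∃! χ : a' ⟶ a, p.map χ = g ∧ χ ≫ φ = φ') :
    p.IsStronglyCartesian (p.map φ) φ where
  universal_property' {a'} g φ' hφ' := by
    obtain ⟨χ, ⟨h₁, h₂⟩, h₃⟩ := h a' g φ' (IsHomLift.eq_of_isHomLift p _ φ').symm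
    refine ⟨χ, ⟨h₁ ▸ inferInstance, h₂⟩, ?_⟩
    rintro ψ ⟨h₄, h₅⟩
    exact h₃ ψ ⟨(IsHomLift.eq_of_isHomLift p _ ψ).symm, h₅⟩

theorem isStronglyCocartesian_map (p : X ⥤ B) {a b : X} (φ : a ⟶ b)
    (h : ∀ (b' : X) (g : p.obj b ⟶ p.obj b') (φ' : a ⟶ b'), p.map φ' = p.map φ ≫ g →
      ∃! χ : b ⟶ b', p.map χ = g ∧ φ ≫ χ = φ') :
    p.IsStronglyCocartesian (p.map φ) φ where
  universal_property' {b'} g φ' hφ' := by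
    obtain ⟨χ, ⟨h₁, h₂⟩, h₃⟩ := h b' g φ' (IsHomLift.eq_of_isHomLift p _ φ').symm
    refine ⟨χ, ⟨h₁ ▸ inferInstance, h₂⟩, ?_⟩
    rintro ψ ⟨h₄, h₅⟩
    exact h₃ ψ ⟨(IsHomLift.eq_of_isHomLift p _ ψ).symm, h₅⟩

/-- A functor over `B` is fibred as soon as it preserves one cartesian lift of each morphism. -/
theorem IsFibredFunctor.of_lifts {P : X ⥤ M} {F : X ⥤ B} {G : M ⥤ B} (h : P ⋙ G = F)
    (hG : G.IsFibered)
    (H : ∀ (x : X) (R : B) (f : R ⟶ F.obj x), ∃ (y : X) (φ : y ⟶ x),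
      F.IsStronglyCartesian f φ ∧ G.IsStronglyCartesian (G.map (P.map φ)) (P.map φ)) :
    IsFibredFunctor P F G where
  isFibered_left := Functor.IsFibered.of_exists_isStronglyCartesian fun x R f =>
    let ⟨y, φ, hφ, _⟩ := H x R f
    ⟨y, φ, hφ⟩
  isFibered_right := hG
  comp_eq := h
  map_cartesian {x y} f hf := by
    obtain ⟨z, ψ, hψ, hψ'⟩ := H y _ (F.map f)
    -- Cartesian lifts of the same morphism differ by a vertical isomorphism, and composing with an
    -- isomorphism preserves cartesianness downstairs.
    let e := Functor.IsCartesian.domainUniqueUpToIso F (F.map f) ψ f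
    have he : e.hom ≫ ψ = f := Functor.IsCartesian.fac F (F.map f) ψ f
    rw [← he, P.map_comp, G.map_comp]
    infer_instance

/-- A functor over `B` restricts to opfibrations on the fibres if vertical morphisms have
opcartesian liftings. -/
theorem isOpfibration_fibreRestriction {P : X ⥤ M} {F : X ⥤ B} {G : M ⥤ B} (h : P ⋙ G = F) (b : B)
    (H : ∀ (x : X) (m : M) (f : P.obj x ⟶ m), IsIso (G.map f) →
      ∃ (y : X) (φ : x ⟶ y), P.IsStronglyCocartesian f φ) :
    IsOpfibration (fibreRestriction h b) := by
  subst h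
  rintro ⟨x, hx⟩ ⟨m, hm⟩ ⟨f, hf⟩
  change P.obj x ⟶ m at f
  have hf' : G.IsHomLift (𝟙 b) f := hf
  have hi : IsIso (G.map f) := by
    rw [IsHomLift.fac' G (𝟙 b) f]
    infer_instance
  obtain ⟨y, φ, hφ⟩ := H x m f hi
  have hy : P.obj y = m := IsHomLift.codomain_eq P f φ
  have hy' : (P ⋙ G).obj y = b := by
    subst hy
    exact hm
  subst hy
  obtain rfl : f = P.map φ := IsHomLift.eq_of_isHomLift P f φ
  -- Verticality is tested after `P`, so both the lifting and the factorizations through it stay in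
  -- the fibre.
  have hv : ∀ {z z' : X} (g : P.obj z ⟶ P.obj z') (ψ : z ⟶ z') [P.IsHomLift g ψ]
      [G.IsHomLift (𝟙 b) g], (P ⋙ G).IsHomLift (𝟙 b) ψ := by
    intro z z' g ψ _ hg
    obtain rfl : g = P.map ψ := IsHomLift.eq_of_isHomLift P g ψ
    exact IsHomLift.of_fac _ _ _ (IsHomLift.domain_eq G (𝟙 b) (P.map ψ))
      (IsHomLift.codomain_eq G (𝟙 b) (P.map ψ)) (IsHomLift.fac G (𝟙 b) (P.map ψ))
  let ψ : Functor.Fiber.mk hx ⟶ Functor.Fiber.mk hy' := ⟨φ, hv (P.map φ) φ⟩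
  refine ⟨⟨y, hy'⟩, ψ, ?_⟩
  refine isStronglyCocartesian_map (fibreRestriction (P := P) (G := G) rfl b) ψ ?_
  rintro ⟨z, hz⟩ ⟨g, hg⟩ ⟨φ', hφ'⟩ he
  change P.obj y ⟶ P.obj z at g
  change x ⟶ z at φ'
  have hg' : G.IsHomLift (𝟙 b) g := hg
  have he' : P.map φ' = P.map φ ≫ g := congrArg Subtype.val he
  have : P.IsHomLift (P.map φ ≫ g) φ' := he' ▸ inferInstance
  obtain ⟨χ, ⟨h₁, h₂⟩, h₃⟩ :=
    Functor.IsStronglyCocartesian.universal_property P (P.map φ) φ g _ rfl φ'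
  refine ⟨⟨χ, hv g χ⟩, ⟨Subtype.ext (IsHomLift.eq_of_isHomLift P g χ).symm, Subtype.ext h₂⟩, ?_⟩
  rintro ⟨θ, hθ⟩ ⟨h₄, h₅⟩
  change y ⟶ z at θ
  have h₄' : P.map θ = g := congrArg Subtype.val h₄
  exact Subtype.ext (h₃ θ ⟨h₄' ▸ inferInstance, congrArg Subtype.val h₅⟩)

/-- If `P` reflects isomorphisms, then its fibres are groupoids. -/
theorem isGroupoid_fiber (P : X ⥤ M) [P.ReflectsIsomorphisms] (m : M) : IsGroupoid (P.Fiber m) where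
  all_isIso {x y} f := by
    have hf : P.IsHomLift (𝟙 m) f.1 := f.2
    have : IsIso (P.map f.1) := by
      rw [IsHomLift.fac' P (𝟙 m) f.1]
      infer_instance
    have : IsIso f.1 := isIso_of_reflects_iso f.1 P
    have : P.IsHomLift (𝟙 m) (inv f.1) := by
      refine IsHomLift.of_fac' _ _ _ y.2 x.2 ?_
      rw [Functor.map_inv, IsIso.inv_eq_of_hom_inv_id]
      simp [IsHomLift.fac' P (𝟙 m) f.1]
    exact ⟨⟨inv f.1, this⟩, Subtype.ext (IsIso.hom_inv_id f.1), Subtype.ext (IsIso.inv_hom_id f.1)⟩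

end Fibrations

/-! ### Group modules -/

namespace GroupModule

theorem isIso_of_bijective {M N : GroupModule.{u}} (f : M ⟶ N)
    (hγ : Function.Bijective (Hom.γ f)) (hβ : Function.Bijective (Hom.β f)) : IsIso f := by
  let c := MulEquiv.ofBijective (Hom.γ f) hγ
  let e := MulEquiv.ofBijective (Hom.β f) hβ
  refine ⟨⟨c.symm.toMonoidHom, e.symm.toMonoidHom, fun x y => ?_⟩, ?_, ?_⟩
  · refine e.symm_apply_eq.mpr ?_
    refine Eq.trans ?_ (Hom.equivariant f _ _).symm
    exact congrArg₂ (· • ·) (c.apply_symm_apply x).symm (e.apply_symm_apply y).symm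
  · exact Hom.ext (MonoidHom.ext c.symm_apply_apply) (MonoidHom.ext e.symm_apply_apply)
  · exact Hom.ext (MonoidHom.ext c.apply_symm_apply) (MonoidHom.ext e.apply_symm_apply)

theorem γ_bijective {M N : GroupModule.{u}} (f : M ⟶ N) [IsIso f] :
    Function.Bijective (Hom.γ f) :=
  Function.bijective_iff_has_inverse.mpr ⟨Hom.γ (inv f),
    fun x => DFunLike.congr_fun (congrArg Hom.γ (IsIso.hom_inv_id f)) x,
    fun x => DFunLike.congr_fun (congrArg Hom.γ (IsIso.inv_hom_id f)) x⟩

theorem β_bijective {M N : GroupModule.{u}} (f : M ⟶ N) [IsIso f] :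
    Function.Bijective (Hom.β f) :=
  Function.bijective_iff_has_inverse.mpr ⟨Hom.β (inv f),
    fun x => DFunLike.congr_fun (congrArg Hom.β (IsIso.hom_inv_id f)) x,
    fun x => DFunLike.congr_fun (congrArg Hom.β (IsIso.inv_hom_id f)) x⟩

/-- The `B`-component of a factorization must be `β⁻¹` after the given one; its equivariance may be
checked after the injective `β`. -/
theorem isStronglyCartesian_of_bijective {M N : GroupModule.{u}} (f : M ⟶ N)
    (hβ : Function.Bijective (Hom.β f)) :
    actingGroup.IsStronglyCartesian (actingGroup.map f) f := by
  refine isStronglyCartesian_map _ _ fun K g k hk => ?_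
  let e := MulEquiv.ofBijective (Hom.β f) hβ
  have he : ∀ x, Hom.β f (e.symm x) = x := e.apply_symm_apply
  have hk' : ∀ c, Hom.γ k c = Hom.γ f (g.hom c) := fun c =>
    DFunLike.congr_fun (congrArg GrpCat.Hom.hom hk) c
  refine ⟨⟨g.hom, e.symm.toMonoidHom.comp (Hom.β k), fun c b => hβ.1 ?_⟩, ⟨rfl, ?_⟩, ?_⟩
  · refine (he _).trans ?_
    rw [Hom.equivariant, Hom.equivariant, hk']
    exact congrArg _ (he _).symm
  · exact Hom.ext (MonoidHom.ext fun c => (hk' c).symm) (MonoidHom.ext fun b => he _)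
  · rintro χ ⟨h₁, h₂⟩
    refine Hom.ext (congrArg GrpCat.Hom.hom h₁) (MonoidHom.ext fun b => hβ.1 ?_)
    exact (DFunLike.congr_fun (congrArg Hom.β h₂) b).trans (he _).symm

/-- Restriction of scalars along a group homomorphism. -/
abbrev restrict (M : GroupModule.{u}) {R : Type u} [Group R] (f : R →* M.C) : GroupModule.{u} :=
  letI := MulDistribMulAction.compHom M.B f
  { C := R, B := M.B }

theorem isFibered_actingGroup : actingGroup.{u}.IsFibered :=
  Functor.IsFibered.of_exists_isStronglyCartesian fun M _ f =>
    ⟨M.restrict f.hom, ⟨f.hom, MonoidHom.id _, fun _ _ => rfl⟩,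
      isStronglyCartesian_of_bijective (M := M.restrict f.hom)
        ⟨f.hom, MonoidHom.id _, fun _ _ => rfl⟩ Function.bijective_id⟩

end GroupModule

/-! ### Crossed extensions -/

namespace CrossedExtension

variable {X Y Z : CrossedExtension.{u}}

/-- Injectivity of `j` and surjectivity of `p` let the middle part determine the outer components.
-/
theorem hom_ext {f g : X ⟶ Y} (h₁ : ∀ x, f.f₁ x = g.f₁ x) (h₂ : ∀ x, f.f₂ x = g.f₂ x) : f = g := by
  refine Hom.ext (MonoidHom.ext h₂) (MonoidHom.ext h₁) (MonoidHom.ext fun b => ?_)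
    (MonoidHom.ext fun c => ?_)
  · exact Y.j_injective (by rw [f.comm_j, g.comm_j, h₂])
  · obtain ⟨x, rfl⟩ := X.p_surjective c
    rw [← f.comm_p, ← g.comm_p, h₁]

/-- A morphism of crossed modules preserves the kernel and the image of the boundary, hence induces
maps on `B` and `C`. With `hom_ext`, morphisms of crossed extensions amount to morphisms of the
underlying crossed modules. -/
theorem exists_extend (f : CrossedModule.Hom X.toCrossedModule Y.toCrossedModule) :
    ∃ F : X ⟶ Y, F.toHom = f := by
  have hβ : ∀ b, ∃ b', Y.j b' = f.f₂ (X.j b) := fun b => Y.exists_j (by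
    rw [f.comm, X.bd_j, map_one])
  -- Quantifying over all lifts `g` of `c` builds independence of the lift into the chosen `γ`,
  -- which makes it multiplicative.
  have hγ : ∀ c, ∃ c', ∀ g, X.p g = c → Y.p (f.f₁ g) = c' := by
    intro c
    obtain ⟨g₀, rfl⟩ := X.p_surjective c
    refine ⟨Y.p (f.f₁ g₀), fun g hg => ?_⟩
    obtain ⟨x, hx⟩ := X.exists_bd (g := g₀⁻¹ * g) (by rw [map_mul, map_inv, hg, inv_mul_cancel])
    have h := Y.p_bd (f.f₂ x)
    rw [f.comm, hx, map_mul, map_mul, map_inv, map_inv, inv_mul_eq_one] at h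
    exact h.symm
  choose β hβ using hβ
  choose γ hγ using hγ
  exact ⟨
    { f with
      β := MonoidHom.mk' β fun a b => Y.j_injective (by simp only [map_mul, hβ])
      γ := MonoidHom.mk' γ fun a b => by
        obtain ⟨g, rfl⟩ := X.p_surjective a
        obtain ⟨h, rfl⟩ := X.p_surjective b
        rw [← hγ _ (g * h) (map_mul _ _ _), ← hγ _ g rfl, ← hγ _ h rfl, map_mul, map_mul]
      comm_j := hβ
      comm_p := fun g => hγ _ g rfl }, rfl⟩

/-- The morphism of crossed extensions induced by a morphism of crossed modules. -/
noncomputable def extend (f : CrossedModule.Hom X.toCrossedModule Y.toCrossedModule) : X ⟶ Y :=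
  (exists_extend f).choose

theorem extend_toHom (f : CrossedModule.Hom X.toCrossedModule Y.toCrossedModule) :
    (extend f).toHom = f :=
  (exists_extend f).choose_spec

@[simp]
theorem extend_f₁ (f : CrossedModule.Hom X.toCrossedModule Y.toCrossedModule) (x : X.G₁) :
    (extend f).f₁ x = f.f₁ x := by
  rw [extend_toHom]

@[simp]
theorem extend_f₂ (f : CrossedModule.Hom X.toCrossedModule Y.toCrossedModule) (x : X.G₂) :
    (extend f).f₂ x = f.f₂ x := by
  rw [extend_toHom]

theorem weakEquivalences_of_bijective (f : X ⟶ Y) (hγ : Function.Bijective f.γ)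
    (hβ : Function.Bijective f.β) : weakEquivalences f :=
  GroupModule.isIso_of_bijective (piFunctor.map f) hγ hβ

theorem weakEquivalences.γ_bijective {f : X ⟶ Y} (h : weakEquivalences f) :
    Function.Bijective f.γ :=
  haveI : IsIso (piFunctor.map f) := h
  GroupModule.γ_bijective (piFunctor.map f)

theorem weakEquivalences.β_bijective {f : X ⟶ Y} (h : weakEquivalences f) :
    Function.Bijective f.β :=
  haveI : IsIso (piFunctor.map f) := h
  GroupModule.β_bijective (piFunctor.map f)

end CrossedExtension

/-- A morphism of crossed modules `S ⟶ Y` which is surjective on the bases and for which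
`S₂ = S₁ ×_{Y₁} Y₂`. -/
structure CrossedModule.Hom.IsPullback {S Y : CrossedModule.{u}} (s : CrossedModule.Hom S Y) :
    Prop where
  surjective : Function.Surjective s.f₁
  exists_lift : ∀ (g : S.G₁) (y : Y.G₂), s.f₁ g = Y.bd y → ∃ x, S.bd x = g ∧ s.f₂ x = y
  injective : ∀ x, S.bd x = 1 → s.f₂ x = 1 → x = 1

/-! ### Pullback of crossed extensions along a surjection on `G₁`. -/

namespace CrossedExtension

variable (Y : CrossedExtension.{u}) {S : CrossedModule.{u}}
  (s : CrossedModule.Hom S Y.toCrossedModule)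

/-- Under `S₂ = S₁ ×_{Y₁} Y₂` the element sought is the pair `(1, j b)`. Such pairs determine
elements of `S₂`, whence multiplicativity. -/
theorem exists_pullback_j (hs : s.IsPullback) :
    ∃ j : Y.B →* S.G₂, ∀ b, S.bd (j b) = 1 ∧ s.f₂ (j b) = Y.j b := by
  have h : ∀ b, ∃ x, S.bd x = 1 ∧ s.f₂ x = Y.j b := fun b =>
    hs.exists_lift 1 (Y.j b) (by rw [Y.bd_j, map_one])
  choose j hj using h
  refine ⟨MonoidHom.mk' j fun a b => ?_, hj⟩
  rw [← mul_inv_eq_one]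
  refine hs.injective _ ?_ ?_
  · simp [(hj _).1]
  · simp [(hj _).2]

/-- The crossed extension structure on a crossed module `S` that is pulled back along a surjection
from one of a crossed extension `Y`. -/
noncomputable def pullback (hs : s.IsPullback) : CrossedExtension.{u} where
  toCrossedModule := S
  B := Y.B
  C := Y.C
  j := (Y.exists_pullback_j s hs).choose
  p := Y.p.comp s.f₁
  j_injective := by
    intro a b h
    apply Y.j_injective
    rw [← ((Y.exists_pullback_j s hs).choose_spec a).2,
      ← ((Y.exists_pullback_j s hs).choose_spec b).2, h]
  exact₂ := by
    ext x
    constructor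
    · rintro ⟨b, rfl⟩
      exact ((Y.exists_pullback_j s hs).choose_spec b).1
    · intro hx
      have hx' : S.bd x = 1 := hx
      obtain ⟨b, hb⟩ := Y.exists_j (x := s.f₂ x) (by rw [s.comm, hx', map_one])
      have hj := (Y.exists_pullback_j s hs).choose_spec b
      refine ⟨b, ?_⟩
      rw [← mul_inv_eq_one]
      refine hs.injective _ ?_ ?_
      · simp [hj.1, hx']
      · simp [hj.2, hb]
  exact₁ := by
    ext g
    constructor
    · rintro ⟨x, rfl⟩
      change Y.p (s.f₁ (S.bd x)) = 1
      rw [← s.comm, Y.p_bd]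
    · intro hg
      obtain ⟨y, hy⟩ := Y.exists_bd (g := s.f₁ g) hg
      obtain ⟨x, hx, -⟩ := hs.exists_lift g y hy.symm
      exact ⟨x, hx⟩
  p_surjective := Y.p_surjective.comp hs.surjective

/-- The projection from a pulled back crossed extension. -/
noncomputable def pullbackHom (hs : s.IsPullback) : Y.pullback s hs ⟶ Y :=
  { s with
    β := MonoidHom.id _
    γ := MonoidHom.id _
    comm_j := fun b => ((Y.exists_pullback_j s hs).choose_spec b).2.symm
    comm_p := fun _ => rfl }

theorem weakEquivalences_pullbackHom (hs : s.IsPullback) :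
    weakEquivalences (Y.pullbackHom s hs) :=
  weakEquivalences_of_bijective _ Function.bijective_id Function.bijective_id

end CrossedExtension

/-! ### The span of a butterfly -/

namespace Butterfly

variable {H G K : CrossedModule.{u}}

/-- Since `γ κ = 1`, conjugation by `κ x` acts trivially on the image of `ι`. This makes `(x, y) ↦ κ
x * ι y` a homomorphism. -/
theorem κ_ι_comm (E : Butterfly H G) (x : H.G₂) (y : G.G₂) : Commute (E.κ x) (E.ι y) := by
  have := E.ι_smul (E.κ x) y
  rw [E.γ_κ, one_smul] at this
  exact (eq_mul_inv_iff_mul_eq.mp this).symm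

/-- The crossed module `H₂ × G₂ → E` of a butterfly. -/
def apex (E : Butterfly H G) : CrossedModule.{u} where
  G₂ := H.G₂ × G.G₂
  G₁ := E.E
  action :=
    { smul := fun e x => (E.δ e • x.1, E.γ e • x.2)
      one_smul := fun x => Prod.ext (by change E.δ 1 • x.1 = _; simp)
        (by change E.γ 1 • x.2 = _; simp)
      mul_smul := fun a b x => Prod.ext
        (by change E.δ (a * b) • x.1 = E.δ a • E.δ b • x.1; rw [map_mul, mul_smul])
        (by change E.γ (a * b) • x.2 = E.γ a • E.γ b • x.2; rw [map_mul, mul_smul])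
      smul_mul := fun a x y => Prod.ext (smul_mul' _ _ _) (smul_mul' _ _ _)
      smul_one := fun a => Prod.ext (smul_one _) (smul_one _) }
  bd := E.κ.noncommCoprod E.ι E.κ_ι_comm
  bd_smul e x := by
    change E.κ (E.δ e • x.1) * E.ι (E.γ e • x.2) = e * (E.κ x.1 * E.ι x.2) * e⁻¹
    rw [E.κ_smul, E.ι_smul]
    group
  peiffer x y := by
    refine Prod.ext ?_ ?_
    · change E.δ (E.κ x.1 * E.ι x.2) • y.1 = x.1 * y.1 * x.1⁻¹
      rw [map_mul, E.δ_κ, E.δ_ι, mul_one, H.peiffer]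
    · change E.γ (E.κ x.1 * E.ι x.2) • y.2 = x.2 * y.2 * x.2⁻¹
      rw [map_mul, E.γ_ι, E.γ_κ, one_mul, G.peiffer]

/-- The left leg of the span of a butterfly. -/
def apexLeft (E : Butterfly H G) : CrossedModule.Hom E.apex H where
  f₂ := MonoidHom.fst _ _
  f₁ := E.δ
  comm x := by
    change H.bd x.1 = E.δ (E.κ x.1 * E.ι x.2)
    rw [map_mul, E.δ_κ, E.δ_ι, mul_one]
  equivariant _ _ := rfl

/-- The right leg of the span of a butterfly. -/
def apexRight (E : Butterfly H G) : CrossedModule.Hom E.apex G where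
  f₂ := MonoidHom.snd _ _
  f₁ := E.γ
  comm x := by
    change G.bd x.2 = E.γ (E.κ x.1 * E.ι x.2)
    rw [map_mul, E.γ_ι, E.γ_κ, one_mul]
  equivariant _ _ := rfl

/-- If `δ e = ∂ x`, then `(κ x)⁻¹ * e` lies in `ker δ = im ι`, so `e = κ x * ι y` for a unique `y`.
-/
theorem isPullback_apexLeft (E : Butterfly H G) : E.apexLeft.IsPullback where
  surjective := E.δ_surjective
  exists_lift (e : E.E) x h := by
    have h' : E.δ e = H.bd x := h
    obtain ⟨y, hy⟩ := E.exists_ι (e := (E.κ x)⁻¹ * e) (by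
      rw [map_mul, map_inv, E.δ_κ, h', inv_mul_cancel])
    exact ⟨(x, y), by change E.κ x * E.ι y = e; rw [hy, mul_inv_cancel_left], rfl⟩
  injective := by
    rintro ⟨x, y⟩ h₁ h₂
    obtain rfl : x = 1 := h₂
    have h₁' : E.κ 1 * E.ι y = 1 := h₁
    rw [map_one, one_mul] at h₁'
    exact Prod.ext rfl (E.ι_injective (h₁'.trans (map_one E.ι).symm))

/-- The crossed module `H₂ × G₂ × K₂ → E ×_{G₁} E'` of two composable butterflies. -/
def compApex (E : Butterfly H G) (E' : Butterfly G K) : CrossedModule.{u} where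
  G₂ := H.G₂ × G.G₂ × K.G₂
  G₁ := pullback E E'
  action :=
    { smul := fun e x => (E.δ e.1.1 • x.1, E.γ e.1.1 • x.2.1, E'.γ e.1.2 • x.2.2)
      one_smul := fun x => Prod.ext (by change E.δ 1 • x.1 = _; simp)
        (Prod.ext (by change E.γ 1 • x.2.1 = _; simp) (by change E'.γ 1 • x.2.2 = _; simp))
      mul_smul := fun a b x => Prod.ext
        (by change E.δ (a.1.1 * b.1.1) • x.1 = E.δ a.1.1 • E.δ b.1.1 • x.1; rw [map_mul, mul_smul])
        (Prod.ext
          (by change E.γ (a.1.1 * b.1.1) • x.2.1 = E.γ a.1.1 • E.γ b.1.1 • x.2.1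
              rw [map_mul, mul_smul])
          (by change E'.γ (a.1.2 * b.1.2) • x.2.2 = E'.γ a.1.2 • E'.γ b.1.2 • x.2.2
              rw [map_mul, mul_smul]))
      smul_mul := fun a x y =>
        Prod.ext (smul_mul' _ _ _) (Prod.ext (smul_mul' _ _ _) (smul_mul' _ _ _))
      smul_one := fun a => Prod.ext (smul_one _) (Prod.ext (smul_one _) (smul_one _)) }
  bd := MonoidHom.mk' (fun x => ⟨(E.κ x.1 * E.ι x.2.1, E'.κ x.2.1 * E'.ι x.2.2), by
      change E.γ (E.κ x.1 * E.ι x.2.1) = E'.δ (E'.κ x.2.1 * E'.ι x.2.2)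
      rw [map_mul, map_mul, E.γ_κ, E.γ_ι, E'.δ_κ, E'.δ_ι, one_mul, mul_one]⟩) fun x y =>
    Subtype.ext (Prod.ext
      (map_mul (E.κ.noncommCoprod E.ι E.κ_ι_comm) (x.1, x.2.1) (y.1, y.2.1))
      (map_mul (E'.κ.noncommCoprod E'.ι E'.κ_ι_comm) (x.2.1, x.2.2) (y.2.1, y.2.2)))
  bd_smul e x := by
    have he : E.γ e.1.1 = E'.δ e.1.2 := e.2
    refine Subtype.ext (Prod.ext ?_ ?_)
    · change E.κ (E.δ e.1.1 • x.1) * E.ι (E.γ e.1.1 • x.2.1) =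
        e.1.1 * (E.κ x.1 * E.ι x.2.1) * e.1.1⁻¹
      rw [E.κ_smul, E.ι_smul]
      group
    · change E'.κ (E.γ e.1.1 • x.2.1) * E'.ι (E'.γ e.1.2 • x.2.2) =
        e.1.2 * (E'.κ x.2.1 * E'.ι x.2.2) * e.1.2⁻¹
      rw [he, E'.κ_smul, E'.ι_smul]
      group
  peiffer x y := by
    refine Prod.ext ?_ (Prod.ext ?_ ?_)
    · change E.δ (E.κ x.1 * E.ι x.2.1) • y.1 = x.1 * y.1 * x.1⁻¹
      rw [map_mul, E.δ_κ, E.δ_ι, mul_one, H.peiffer]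
    · change E.γ (E.κ x.1 * E.ι x.2.1) • y.2.1 = x.2.1 * y.2.1 * x.2.1⁻¹
      rw [map_mul, E.γ_ι, E.γ_κ, one_mul, G.peiffer]
    · change E'.γ (E'.κ x.2.1 * E'.ι x.2.2) • y.2.2 = x.2.2 * y.2.2 * x.2.2⁻¹
      rw [map_mul, E'.γ_ι, E'.γ_κ, one_mul, K.peiffer]

/-- The projection of `compApex E E'` onto the apex of `E`. -/
def compApexFst (E : Butterfly H G) (E' : Butterfly G K) :
    CrossedModule.Hom (compApex E E') E.apex where
  f₂ := (MonoidHom.fst _ _).prod ((MonoidHom.fst _ _).comp (MonoidHom.snd _ _))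
  f₁ := (MonoidHom.fst _ _).comp (Subgroup.subtype _)
  comm _ := rfl
  equivariant _ _ := rfl

/-- The projection of `compApex E E'` onto the apex of `E'`. -/
def compApexSnd (E : Butterfly H G) (E' : Butterfly G K) :
    CrossedModule.Hom (compApex E E') E'.apex where
  f₂ := MonoidHom.snd _ _
  f₁ := (MonoidHom.snd _ _).comp (Subgroup.subtype _)
  comm _ := rfl
  equivariant e x := by
    have he : E.γ e.1.1 = E'.δ e.1.2 := e.2
    exact Prod.ext (congrArg (· • x.2.1) he) rfl

/-- The projection of `compApex E E'` onto the apex of the composite. -/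
def compApexComp (E : Butterfly H G) (E' : Butterfly G K) :
    CrossedModule.Hom (compApex E E') (comp E E').apex where
  f₂ := (MonoidHom.fst _ _).prod ((MonoidHom.snd _ _).comp (MonoidHom.snd _ _))
  f₁ := compMk E E'
  comm x := by
    refine (map_mul (compMk E E') _ _).symm.trans (compMk_eq x.2.1 ?_ ?_)
    · change E.κ x.1 * 1 * E.ι x.2.1 = E.κ x.1 * E.ι x.2.1
      rw [mul_one]
    · change 1 * E'.ι x.2.2 * E'.κ x.2.1 = E'.κ x.2.1 * E'.ι x.2.2
      rw [one_mul, (E'.κ_ι_comm _ _).eq]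
  equivariant _ _ := rfl

/-- The argument for the left leg, applied to `E'` in the second coordinate. It makes this
projection a weak equivalence. -/
theorem isPullback_compApexFst (E : Butterfly H G) (E' : Butterfly G K) :
    (compApexFst E E').IsPullback where
  surjective e := by
    obtain ⟨e', he'⟩ := E'.δ_surjective (E.γ e)
    exact ⟨⟨(e, e'), he'.symm⟩, rfl⟩
  exists_lift := by
    rintro ⟨⟨e, e'⟩, he⟩ ⟨x, y⟩ h
    have he' : E.γ e = E'.δ e' := he
    obtain rfl : e = E.κ x * E.ι y := h
    rw [map_mul, E.γ_κ, E.γ_ι, one_mul] at he'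
    obtain ⟨z, hz⟩ := E'.exists_ι (e := (E'.κ y)⁻¹ * e') (by
      rw [map_mul, map_inv, E'.δ_κ, he', inv_mul_cancel])
    refine ⟨(x, y, z), Subtype.ext (Prod.ext rfl ?_), rfl⟩
    change E'.κ y * E'.ι z = e'
    rw [hz, mul_inv_cancel_left]
  injective := by
    rintro ⟨x, y, z⟩ h₁ h₂
    obtain ⟨rfl, rfl⟩ := Prod.mk.inj h₂
    have h₁' : E'.κ 1 * E'.ι z = 1 := congrArg (fun e => e.1.2) h₁
    rw [map_one, one_mul] at h₁'
    exact Prod.ext rfl (Prod.ext rfl (E'.ι_injective (h₁'.trans (map_one E'.ι).symm)))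

/-- The section of the left leg of the span of a representable butterfly. -/
def apexSection (f : CrossedModule.Hom H G) : CrossedModule.Hom H (ofHom f).apex where
  f₂ := (MonoidHom.id _).prod f.f₂
  f₁ := SemidirectProduct.inr
  comm x := by
    refine SemidirectProduct.ext ?_ ?_
    · change (f.f₂ x)⁻¹ * f.f₁ (H.bd x) • f.f₂ x = 1
      rw [← f.comm, G.peiffer]
      group
    · exact mul_one (H.bd x)
  equivariant g x := by
    refine Prod.ext rfl ?_
    change f.f₂ (g • x) = (G.bd 1 * f.f₁ g) • f.f₂ x
    rw [f.equivariant, map_one, one_mul]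

/-- The morphism of apices induced by a 2-cell. -/
def Hom.apexMap {E F : Butterfly H G} (φ : Hom E F) : CrossedModule.Hom E.apex F.apex where
  f₂ := MonoidHom.id _
  f₁ := φ.α
  comm x := by
    change F.κ x.1 * F.ι x.2 = φ.α (E.κ x.1 * E.ι x.2)
    rw [map_mul, φ.α_κ, φ.α_ι]
  equivariant e x := Prod.ext (congrArg (· • x.1) (φ.δ_α e).symm)
    (congrArg (· • x.2) (φ.γ_α e).symm)

end Butterfly

/-! ### Composition with representable butterflies, and reversal -/

namespace Butterfly

variable {H G K S : CrossedModule.{u}}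

/-- Precomposing with a representable butterfly pulls the extension `E` back along `s.f₁`; a map `θ`
of extensions over `s.f₁` that fixes `K₂` and respects `κ` and `γ` recognizes this pullback. Only a
2-cell is needed, since all are invertible. -/
theorem isomorphic_ofHom_comp (s : CrossedModule.Hom S H) (E : Butterfly H K) (F : Butterfly S K)
    (θ : F.E →* E.E) (hκ : ∀ x, θ (F.κ x) = E.κ (s.f₂ x)) (hι : ∀ y, θ (F.ι y) = E.ι y)
    (hδ : ∀ e, E.δ (θ e) = s.f₁ (F.δ e)) (hγ : ∀ e, E.γ (θ e) = F.γ e) :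
    Isomorphic F (comp (ofHom s) E) :=
  Hom.isomorphic
    { α := (compMk (ofHom s) E).comp
        { toFun := fun e => ⟨(⟨1, F.δ e⟩, θ e), by
            change H.bd 1 * s.f₁ (F.δ e) = E.δ (θ e)
            rw [map_one, one_mul, hδ]⟩
          map_one' := Subtype.ext (Prod.ext (SemidirectProduct.ext rfl (map_one F.δ)) (map_one θ))
          map_mul' := fun a b => Subtype.ext (Prod.ext
            (SemidirectProduct.ext (by simp : (1 : H.G₂) = 1 * (s.f₁ (F.δ a) • 1))
              (map_mul F.δ a b)) (map_mul θ a b)) }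
      α_κ := fun x => (compMk_eq (s.f₂ x) (by
        refine SemidirectProduct.ext ?_ ?_
        · change (s.f₂ x)⁻¹ * s.f₁ (S.bd x) • s.f₂ x = 1
          rw [← s.comm, H.peiffer]
          group
        · change S.bd x * 1 = F.δ (F.κ x)
          rw [F.δ_κ, mul_one]) ((one_mul _).trans (hκ x).symm)).symm
      α_ι := fun y => congrArg (compMk (ofHom s) E) (Subtype.ext (Prod.ext
        (SemidirectProduct.ext rfl (F.δ_ι y)) (hι y)))
      δ_α := fun e => rfl
      γ_α := hγ }

/-- Dually, postcomposing pushes the extension forward along `f.f₂`; the 2-cell is `[e, (z, γ e)] ↦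
ι z * θ e`. -/
theorem comp_ofHom_isomorphic (E : Butterfly H G) (f : CrossedModule.Hom G K) (F : Butterfly H K)
    (θ : E.E →* F.E) (hκ : ∀ x, θ (E.κ x) = F.κ x) (hι : ∀ y, θ (E.ι y) = F.ι (f.f₂ y))
    (hδ : ∀ e, F.δ (θ e) = E.δ e) (hγ : ∀ e, F.γ (θ e) = f.f₁ (E.γ e)) :
    Isomorphic (comp E (ofHom f)) F :=
  Hom.isomorphic
    { α := QuotientGroup.lift _ (MonoidHom.mk' (fun q => F.ι q.1.2.left * θ q.1.1) (by
          rintro ⟨⟨e, ⟨z, g⟩⟩, he⟩ ⟨⟨e', ⟨z', g'⟩⟩, he'⟩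
          obtain rfl : E.γ e = g := he
          change F.ι (z * f.f₁ (E.γ e) • z') * θ (e * e') = F.ι z * θ e * (F.ι z' * θ e')
          rw [map_mul, map_mul, ← hγ, F.ι_smul]
          group)) (by
        rintro _ ⟨y, rfl⟩
        change F.ι (f.f₂ y)⁻¹ * θ (E.ι y) = 1
        rw [hι, map_inv, inv_mul_cancel])
      α_κ := fun x => by
        change F.ι 1 * θ (E.κ x) = F.κ x
        rw [map_one, one_mul, hκ]
      α_ι := fun z => by
        change F.ι z * θ 1 = F.ι z
        rw [map_one, mul_one]
      δ_α := fun q => by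
        obtain ⟨⟨⟨e, z⟩, he⟩, rfl⟩ := compMk_surjective _ _ q
        change F.δ (F.ι z.left * θ e) = E.δ e
        rw [map_mul, F.δ_ι, one_mul, hδ]
      γ_α := fun q => by
        obtain ⟨⟨⟨e, ⟨z, g⟩⟩, he⟩, rfl⟩ := compMk_surjective _ _ q
        obtain rfl : E.γ e = g := he
        change F.γ (F.ι z * θ e) = K.bd z * f.f₁ (E.γ e)
        rw [map_mul, F.γ_ι, hγ] }

/-- A butterfly both of whose diagonals are extensions. -/
structure IsFlippable (E : Butterfly H G) : Prop where
  κ_injective : Function.Injective E.κ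
  exact : E.κ.range = E.γ.ker
  γ_surjective : Function.Surjective E.γ

/-- The reversed butterfly. -/
def flip (E : Butterfly H G) (h : E.IsFlippable) : Butterfly G H where
  E := E.E
  κ := E.ι
  ι := E.κ
  δ := E.γ
  γ := E.δ
  δ_κ := E.γ_ι
  γ_ι := E.δ_κ
  γ_κ := E.δ_ι
  ι_injective := h.κ_injective
  exact := h.exact
  δ_surjective := h.γ_surjective
  κ_smul := E.ι_smul
  ι_smul := E.κ_smul

theorem isFlippable_flip (E : Butterfly H G) (h : E.IsFlippable) : (E.flip h).IsFlippable where
  κ_injective := E.ι_injective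
  exact := E.exact
  γ_surjective := E.δ_surjective

/-- A 2-cell may be given on a group `T` covering `E`, provided the kernel of the cover is killed.
This avoids choosing preimages. -/
theorem isomorphic_of_surjective {E F : Butterfly H G} {T : Type*} [Group T] (a : T →* E.E)
    (b : T →* F.E) (ha : Function.Surjective a) (hab : ∀ t, a t = 1 → b t = 1)
    (hκ : ∀ x, ∃ t, a t = E.κ x ∧ b t = F.κ x) (hι : ∀ y, ∃ t, a t = E.ι y ∧ b t = F.ι y)
    (hδ : ∀ t, F.δ (b t) = E.δ (a t)) (hγ : ∀ t, F.γ (b t) = E.γ (a t)) : Isomorphic E F := by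
  have hα : ∀ t, a.liftOfSurjective ha ⟨b, hab⟩ (a t) = b t :=
    fun t => MonoidHom.liftOfRightInverse_comp_apply _ _ _ _ t
  exact Hom.isomorphic
    { α := a.liftOfSurjective ha ⟨b, hab⟩
      α_κ := fun x => by
        obtain ⟨t, h₁, h₂⟩ := hκ x
        rw [← h₁, hα, h₂]
      α_ι := fun y => by
        obtain ⟨t, h₁, h₂⟩ := hι y
        rw [← h₁, hα, h₂]
      δ_α := fun e => by
        obtain ⟨t, rfl⟩ := ha e
        rw [hα, hδ]
      γ_α := fun e => by
        obtain ⟨t, rfl⟩ := ha e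
        rw [hα, hγ] }

/-- As `ker γ = im κ`, the kernel pair of `γ` is `H₂ ⋊ E` via `(x, e) ↦ (e, κ x * e)`. Dividing by
the diagonal copy of `G₂ = ker δ` leaves `H₂ ⋊ H₁`, the identity butterfly. -/
theorem id_isomorphic_comp_flip (E : Butterfly H G) (h : E.IsFlippable) :
    Isomorphic (id H) (comp E (E.flip h)) := by
  let T := H.G₂ ⋊[(MulDistribMulAction.toMulAut H.G₁ H.G₂).comp E.δ] E.E
  let a : T →* (id H).E := SemidirectProduct.map (MonoidHom.id _) E.δ (fun _ => rfl)
  let b : T →* pullback E (E.flip h) := MonoidHom.mk'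
    (fun t => ⟨(t.right, E.κ t.left * t.right), by
      change E.γ t.right = E.γ (E.κ t.left * t.right)
      rw [map_mul, E.γ_κ, one_mul]⟩) (fun s t => Subtype.ext (Prod.ext rfl (by
        change E.κ (s.left * E.δ s.right • t.left) * (s.right * t.right) =
          E.κ s.left * s.right * (E.κ t.left * t.right)
        rw [map_mul, E.κ_smul]
        group)))
  refine isomorphic_of_surjective (E := id H) (F := comp E (E.flip h)) a
    ((compMk E (E.flip h)).comp b) ?_ ?_ (fun x => ⟨⟨x⁻¹, E.κ x⟩, ?_, ?_⟩)
    (fun y => ⟨⟨y, 1⟩, ?_, ?_⟩) (fun t => rfl) (fun t => ?_)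
  · rintro ⟨x, g⟩
    obtain ⟨e, rfl⟩ := E.δ_surjective g
    exact ⟨⟨x, e⟩, rfl⟩
  · rintro ⟨x, e⟩ hx
    have h₁ : x = 1 := congrArg SemidirectProduct.left hx
    have h₂ : E.δ e = 1 := congrArg SemidirectProduct.right hx
    obtain ⟨y, rfl⟩ := E.exists_ι h₂
    refine compMk_eq_one.mpr ⟨y, rfl, ?_⟩
    change E.ι y = E.κ x * E.ι y
    rw [h₁, map_one, one_mul]
  · exact SemidirectProduct.ext rfl (E.δ_κ x)
  · refine congrArg (compMk E (E.flip h)) (Subtype.ext (Prod.ext rfl ?_))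
    change E.κ x⁻¹ * E.κ x = 1
    rw [map_inv, inv_mul_cancel]
  · exact SemidirectProduct.ext rfl (map_one E.δ)
  · exact congrArg (compMk E (E.flip h)) (Subtype.ext (Prod.ext rfl (mul_one (E.κ y))))
  · change E.δ (E.κ t.left * t.right) = H.bd t.left * E.δ t.right
    rw [map_mul, E.δ_κ]

/-- The map `(y, e) ↦ ι y * e` from `G₂ ⋊ E` to `E` covers `δ`, which exhibits `G₂ ⋊ E` as the
pullback of `E` along the left leg. -/
theorem ofHom_apexRight_isomorphic (E : Butterfly H G) :
    Isomorphic (ofHom E.apexRight) (comp (ofHom E.apexLeft) E) := by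
  have hmul (y y' : G.G₂) (e e' : E.E) :
      E.ι (y * E.γ e • y') * (e * e') = E.ι y * e * (E.ι y' * e') := by
    rw [map_mul, E.ι_smul]
    group
  let θ : (ofHom E.apexRight).E →* E.E := MonoidHom.mk'
    (fun e => E.ι e.left * show E.E from e.right) fun a b => hmul a.left b.left a.right b.right
  refine isomorphic_ofHom_comp E.apexLeft E (ofHom E.apexRight) θ (fun x => ?_) (fun y => ?_)
    (fun e => ?_) (fun e => ?_)
  · change E.ι x.2⁻¹ * (E.κ x.1 * E.ι x.2) = E.κ x.1
    rw [(E.κ_ι_comm _ _).eq, map_inv, inv_mul_cancel_left]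
  · exact mul_one (E.ι y)
  · change E.δ (E.ι e.left * _) = E.δ e.right
    rw [map_mul, E.δ_ι, one_mul]
  · change E.γ (E.ι e.left * _) = G.bd e.left * E.γ e.right
    rw [map_mul, E.γ_ι]

end Butterfly

/-! ### The universal property of `Q` -/

namespace BExt

open CrossedExtension

variable {X Y Z : CrossedExtension.{u}}

/-- The morphism of `[BExt](Gp)` represented by a butterfly. -/
def homMk (E : Butterfly X.toCrossedModule Y.toCrossedModule) : Q.obj X ⟶ Q.obj Y :=
  Quotient.mk _ E

theorem homMk_surjective (f : Q.obj X ⟶ Q.obj Y) :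
    ∃ E : Butterfly X.toCrossedModule Y.toCrossedModule, homMk E = f :=
  Quotient.exists_rep f

theorem homMk_eq {E F : Butterfly X.toCrossedModule Y.toCrossedModule}
    (h : Butterfly.Isomorphic E F) : homMk E = homMk F :=
  Quotient.sound h

theorem isomorphic_of_homMk_eq {E F : Butterfly X.toCrossedModule Y.toCrossedModule}
    (h : homMk E = homMk F) : Butterfly.Isomorphic E F :=
  Quotient.exact h

theorem isIso_homMk (E : Butterfly X.toCrossedModule Y.toCrossedModule) (h : E.IsFlippable) :
    IsIso (homMk E) :=
  ⟨homMk (E.flip h), (homMk_eq (E.id_isomorphic_comp_flip h)).symm,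
    (homMk_eq ((E.flip h).id_isomorphic_comp_flip (E.isFlippable_flip h))).symm⟩

/-- A diagram chase: injectivity of `β` gives injectivity of `κ`, injectivity of `f.γ` with
surjectivity of `β` gives exactness at the middle, and surjectivity of `f.γ` gives surjectivity of
the wing `γ`. -/
theorem isFlippable_ofHom (f : X ⟶ Y) (hγ : Function.Bijective f.γ) (hβ : Function.Bijective f.β) :
    (Butterfly.ofHom f.toHom).IsFlippable where
  κ_injective := by
    refine (injective_iff_map_eq_one _).mpr fun x hx => ?_
    have h₁ : (f.f₂ x)⁻¹ = 1 := congrArg SemidirectProduct.left hx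
    have h₂ : X.bd x = 1 := congrArg SemidirectProduct.right hx
    obtain ⟨b, rfl⟩ := X.exists_j h₂
    rw [inv_eq_one, ← f.comm_j, ← map_one Y.j] at h₁
    have h₃ := Y.j_injective h₁
    rw [← map_one f.β] at h₃
    rw [hβ.1 h₃, map_one]
  exact := by
    ext ⟨y, g⟩
    constructor
    · rintro ⟨x, hx⟩
      rw [← hx]
      exact (Butterfly.ofHom f.toHom).γ_κ x
    · intro h
      have h' : Y.bd y * f.f₁ g = 1 := h
      have hg : X.p g = 1 := by
        have := congrArg Y.p h'
        rw [map_mul, Y.p_bd, one_mul, map_one, f.comm_p, ← map_one f.γ] at this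
        exact hγ.1 this
      obtain ⟨x, rfl⟩ := X.exists_bd hg
      rw [← f.comm, ← map_mul] at h'
      obtain ⟨b, hb⟩ := Y.exists_j h'
      -- The element `x` is only determined up to `ker ∂`. The discrepancy `y * f₂ x` lies in `ker
      -- ∂`, so it comes from `X.B` and can be divided out.
      obtain ⟨b, rfl⟩ := hβ.2 b
      rw [f.comm_j] at hb
      refine ⟨x * (X.j b)⁻¹, SemidirectProduct.ext ?_ ?_⟩
      · change (f.f₂ (x * (X.j b)⁻¹))⁻¹ = y
        rw [map_mul, map_inv, hb]
        group
      · change X.bd (x * (X.j b)⁻¹) = X.bd x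
        rw [map_mul, map_inv, X.bd_j, inv_one, mul_one]
  γ_surjective g := by
    obtain ⟨c, hc⟩ := hγ.2 (Y.p g)
    obtain ⟨h, rfl⟩ := X.p_surjective c
    obtain ⟨y, hy⟩ := Y.exists_bd (g := g * (f.f₁ h)⁻¹) (by
      rw [map_mul, map_inv, f.comm_p, hc, mul_inv_cancel])
    refine ⟨⟨y, h⟩, ?_⟩
    change Y.bd y * f.f₁ h = g
    rw [hy, inv_mul_cancel_right]

theorem isInvertedBy_Q : weakEquivalences.{u}.IsInvertedBy Q.{u} := fun _ _ f hf =>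
  isIso_homMk _ (isFlippable_ofHom f hf.γ_bijective hf.β_bijective)

/-! ### Butterflies as fractions of morphisms of crossed extensions. -/

/-- The apex of the span of a butterfly between crossed extensions. -/
noncomputable def apex (E : Butterfly X.toCrossedModule Y.toCrossedModule) :
    CrossedExtension.{u} :=
  X.pullback E.apexLeft E.isPullback_apexLeft

/-- The left leg of the span of a butterfly between crossed extensions. -/
noncomputable def left (E : Butterfly X.toCrossedModule Y.toCrossedModule) : apex E ⟶ X :=
  X.pullbackHom E.apexLeft E.isPullback_apexLeft

/-- The right leg of the span of a butterfly between crossed extensions. -/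
noncomputable def right (E : Butterfly X.toCrossedModule Y.toCrossedModule) : apex E ⟶ Y :=
  extend (X := apex E) E.apexRight

theorem weakEquivalences_left (E : Butterfly X.toCrossedModule Y.toCrossedModule) :
    weakEquivalences (left E) :=
  X.weakEquivalences_pullbackHom E.apexLeft E.isPullback_apexLeft

theorem right_f₁ (E : Butterfly X.toCrossedModule Y.toCrossedModule) (e : E.E) :
    (right E).f₁ e = E.γ e :=
  extend_f₁ (X := apex E) E.apexRight e

theorem right_f₂ (E : Butterfly X.toCrossedModule Y.toCrossedModule) (x : X.G₂ × Y.G₂) :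
    (right E).f₂ x = x.2 :=
  extend_f₂ (X := apex E) E.apexRight x

/-- Because `Q` inverts the left leg, this relation presents every morphism of `[BExt](Gp)` as a
fraction. -/
theorem Q_left_comp (E : Butterfly X.toCrossedModule Y.toCrossedModule) :
    Q.map (left E) ≫ homMk E = Q.map (right E) := by
  have h : Q.map (right E) = homMk (X := apex E) (Butterfly.ofHom E.apexRight) :=
    congrArg (fun f => homMk (X := apex E) (Butterfly.ofHom f))
      (extend_toHom (X := apex E) E.apexRight)
  rw [h]
  exact (homMk_eq (X := apex E) E.ofHom_apexRight_isomorphic).symm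

/-- The value on a butterfly of the functor induced by a functor inverting weak equivalences. -/
noncomputable def liftMap {D : Type w₁} [Category.{v₁} D] (F : CrossedExtension.{u} ⥤ D)
    (hF : weakEquivalences.IsInvertedBy F) (E : Butterfly X.toCrossedModule Y.toCrossedModule) :
    F.obj X ⟶ F.obj Y :=
  haveI := hF _ (weakEquivalences_left E)
  inv (F.map (left E)) ≫ F.map (right E)

section

variable {D : Type w₁} [Category.{v₁} D] (F : CrossedExtension.{u} ⥤ D)
  (hF : weakEquivalences.IsInvertedBy F)

theorem left_liftMap (E : Butterfly X.toCrossedModule Y.toCrossedModule) :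
    F.map (left E) ≫ liftMap F hF E = F.map (right E) := by
  simp [liftMap]

theorem left_liftMap_assoc (E : Butterfly X.toCrossedModule Y.toCrossedModule) {d : D}
    (g : F.obj Y ⟶ d) : F.map (left E) ≫ liftMap F hF E ≫ g = F.map (right E) ≫ g := by
  rw [← Category.assoc, left_liftMap]

theorem eq_liftMap (E : Butterfly X.toCrossedModule Y.toCrossedModule) (g : F.obj X ⟶ F.obj Y)
    (hg : F.map (left E) ≫ g = F.map (right E)) : g = liftMap F hF E := by
  have := hF _ (weakEquivalences_left E)
  rw [← cancel_epi (F.map (left E)), hg, left_liftMap]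

/-- A 2-cell induces a map of apices commuting with both legs, so the two fractions agree. -/
theorem liftMap_congr {E E' : Butterfly X.toCrossedModule Y.toCrossedModule}
    (h : Butterfly.Isomorphic E E') : liftMap F hF E = liftMap F hF E' := by
  obtain ⟨φ, -⟩ := h
  let m : apex E ⟶ apex E' := extend (X := apex E) (Y := apex E') φ.apexMap
  have h₁ (e : E.E) : m.f₁ e = φ.α e := extend_f₁ (X := apex E) (Y := apex E') φ.apexMap e
  have h₂ (x : X.G₂ × Y.G₂) : m.f₂ x = x := extend_f₂ (X := apex E) (Y := apex E') φ.apexMap x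
  have hl : m ≫ left E' = left E := hom_ext
    (fun (e : E.E) => (congrArg E'.δ (h₁ e)).trans (φ.δ_α e))
    (fun x => congrArg Prod.fst (h₂ x))
  have hr : m ≫ right E' = right E := by
    refine hom_ext (fun (e : E.E) => ?_) (fun x => ?_)
    · exact (congrArg (right E').f₁ (h₁ e)).trans
        ((right_f₁ E' _).trans ((φ.γ_α e).trans (right_f₁ E e).symm))
    · exact (congrArg (right E').f₂ (h₂ x)).trans ((right_f₂ E' x).trans (right_f₂ E x).symm)
  refine (eq_liftMap F hF E _ ?_).symm
  rw [← hl, ← hr, F.map_comp, F.map_comp, Category.assoc, left_liftMap]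

/-- The left leg of a representable butterfly has a section `s`, and `s` followed by the right leg
is `f`. -/
theorem liftMap_ofHom (f : X ⟶ Y) : liftMap F hF (Butterfly.ofHom f.toHom) = F.map f := by
  let E := Butterfly.ofHom f.toHom
  let s : X ⟶ apex E := extend (Y := apex E) (Butterfly.apexSection f.toHom)
  have h₁ (g : X.G₁) : s.f₁ g = (SemidirectProduct.inr g : E.E) :=
    extend_f₁ (Y := apex E) (Butterfly.apexSection f.toHom) g
  have h₂ (x : X.G₂) : s.f₂ x = (x, f.f₂ x) :=
    extend_f₂ (Y := apex E) (Butterfly.apexSection f.toHom) x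
  have hl : s ≫ left E = 𝟙 X := by
    refine hom_ext (fun g => ?_) (fun x => ?_)
    · exact congrArg E.δ (h₁ g)
    · exact congrArg Prod.fst (h₂ x)
  have hr : s ≫ right E = f := by
    refine hom_ext (fun g => ?_) (fun x => ?_)
    · refine (congrArg (right E).f₁ (h₁ g)).trans ((right_f₁ E _).trans ?_)
      change Y.bd 1 * f.f₁ g = f.f₁ g
      rw [map_one, one_mul]
    · exact (congrArg (right E).f₂ (h₂ x)).trans (right_f₂ E _)
  have h := congrArg (F.map s ≫ ·) (left_liftMap F hF E)
  simp only [← F.map_comp, ← F.map_comp_assoc, hl, hr, F.map_id, Category.id_comp] at h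
  exact h

/-- The crossed extension `W` over `E ×_{G₁} E'` completes the two spans to a larger roof and also
maps to the span of the composite. The three squares `hac`, `hab`, `hbc` compare the fractions over
`W`. -/
theorem liftMap_comp (E : Butterfly X.toCrossedModule Y.toCrossedModule)
    (E' : Butterfly Y.toCrossedModule Z.toCrossedModule) :
    liftMap F hF (E.comp E') = liftMap F hF E ≫ liftMap F hF E' := by
  let W := (apex E).pullback (Butterfly.compApexFst E E') (Butterfly.isPullback_compApexFst E E')
  let a : W ⟶ apex E :=
    (apex E).pullbackHom (Butterfly.compApexFst E E') (Butterfly.isPullback_compApexFst E E')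
  let b : W ⟶ apex E' := extend (X := W) (Y := apex E') (Butterfly.compApexSnd E E')
  let c : W ⟶ apex (E.comp E') :=
    extend (X := W) (Y := apex (E.comp E')) (Butterfly.compApexComp E E')
  have hb₁ (e : Butterfly.pullback E E') : b.f₁ e = e.1.2 :=
    extend_f₁ (X := W) (Y := apex E') (Butterfly.compApexSnd E E') e
  have hb₂ (x : X.G₂ × Y.G₂ × Z.G₂) : b.f₂ x = x.2 :=
    extend_f₂ (X := W) (Y := apex E') (Butterfly.compApexSnd E E') x
  have hc₁ (e : Butterfly.pullback E E') : c.f₁ e = Butterfly.compMk E E' e :=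
    extend_f₁ (X := W) (Y := apex (E.comp E')) (Butterfly.compApexComp E E') e
  have hc₂ (x : X.G₂ × Y.G₂ × Z.G₂) : c.f₂ x = (x.1, x.2.2) :=
    extend_f₂ (X := W) (Y := apex (E.comp E')) (Butterfly.compApexComp E E') x
  have hac : c ≫ left (E.comp E') = a ≫ left E := hom_ext
    (fun (e : Butterfly.pullback E E') => congrArg (E.comp E').δ (hc₁ e))
    (fun x => congrArg Prod.fst (hc₂ x))
  have hab : b ≫ left E' = a ≫ right E := by
    refine hom_ext (fun (e : Butterfly.pullback E E') => ?_) (fun x => ?_)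
    · refine (congrArg E'.δ (hb₁ e)).trans (e.2.symm.trans (right_f₁ E e.1.1).symm)
    · exact (congrArg Prod.fst (hb₂ x)).trans (right_f₂ E (x.1, x.2.1)).symm
  have hbc : c ≫ right (E.comp E') = b ≫ right E' := by
    refine hom_ext (fun (e : Butterfly.pullback E E') => ?_) (fun x => ?_)
    · exact (congrArg (right (E.comp E')).f₁ (hc₁ e)).trans ((right_f₁ (E.comp E') _).trans
        ((right_f₁ E' e.1.2).symm.trans (congrArg (right E').f₁ (hb₁ e).symm)))
    · exact (congrArg (right (E.comp E')).f₂ (hc₂ x)).trans ((right_f₂ (E.comp E') _).trans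
        ((right_f₂ E' x.2).symm.trans (congrArg (right E').f₂ (hb₂ x).symm)))
  have : IsIso (F.map a) := hF _ ((apex E).weakEquivalences_pullbackHom _ _)
  have : IsIso (F.map (left E)) := hF _ (weakEquivalences_left E)
  have : IsIso (F.map (left (E.comp E'))) := hF _ (weakEquivalences_left _)
  -- Two out of three for isomorphisms in `hac`; `c` itself need not be analysed.
  have : IsIso (F.map c) := by
    have h : F.map c = F.map a ≫ F.map (left E) ≫ inv (F.map (left (E.comp E'))) := by
      rw [← Category.assoc, IsIso.eq_comp_inv, ← F.map_comp, ← F.map_comp, hac]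
    rw [h]
    infer_instance
  refine (eq_liftMap F hF _ _ ?_).symm
  rw [← cancel_epi (F.map c), ← F.map_comp_assoc, hac, ← F.map_comp, hbc, F.map_comp,
    Category.assoc, left_liftMap_assoc, ← F.map_comp_assoc, ← hab, F.map_comp, Category.assoc,
    left_liftMap, F.map_comp]

/-- The functor on `[BExt](Gp)` induced by a functor inverting weak equivalences. -/
noncomputable def lift : BExt.{u} ⥤ D where
  obj X := F.obj X
  map {X Y} := Quotient.lift (liftMap F hF (X := X) (Y := Y)) fun _ _ => liftMap_congr F hF
  map_id X := (liftMap_ofHom F hF (𝟙 (show CrossedExtension from X))).trans (F.map_id _)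
  map_comp := by
    rintro X Y Z ⟨E⟩ ⟨E'⟩
    exact liftMap_comp F hF E E'

theorem Q_comp_lift : Q ⋙ lift F hF = F :=
  Functor.hext (fun _ => rfl) fun _ _ f => heq_of_eq (liftMap_ofHom F hF f)

end

/-- The functors agree on both legs of each span, and the left leg may be cancelled. The `eqToHom`s
account for values on objects that are equal only propositionally. -/
theorem functor_ext {D : Type w₁} [Category.{v₁} D] (F₁ F₂ : BExt.{u} ⥤ D)
    (h : Q ⋙ F₁ = Q ⋙ F₂) : F₁ = F₂ := by
  suffices H : ∀ (X Y : CrossedExtension.{u})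
      (E : Butterfly X.toCrossedModule Y.toCrossedModule), F₁.map (homMk E) =
        eqToHom (Functor.congr_obj h X) ≫ F₂.map (homMk E) ≫
          eqToHom (Functor.congr_obj h Y).symm by
    refine CategoryTheory.Functor.ext (fun X => Functor.congr_obj h X) fun X Y f => ?_
    obtain ⟨E, rfl⟩ := homMk_surjective (X := X) (Y := Y) f
    exact H X Y E
  intro X Y E
  have : IsIso (Q.map (left E)) := isInvertedBy_Q _ (weakEquivalences_left E)
  have hl : F₁.map (Q.map (left E)) = _ := Functor.congr_hom h (left E)
  have hr : F₁.map (Q.map (right E)) = _ := Functor.congr_hom h (right E)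
  rw [← cancel_epi (F₁.map (Q.map (left E)))]
  refine (F₁.map_comp _ _).symm.trans ?_
  rw [Q_left_comp, hr, hl]
  simp only [Functor.comp_map, ← Q_left_comp, Functor.map_comp, Category.assoc, eqToHom_trans_assoc,
    eqToHom_refl, Category.id_comp]

/-- `Q` is strictly universal among functors inverting weak equivalences. -/
noncomputable def strictUniversalProperty (D : Type w₁) [Category.{v₁} D] :
    Localization.StrictUniversalPropertyFixedTarget Q.{u} weakEquivalences.{u} D where
  inverts := isInvertedBy_Q
  lift := lift
  fac := Q_comp_lift
  uniq := functor_ext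

end BExt

/-! ### Base change of crossed extensions -/

namespace CrossedExtension

variable (X : CrossedExtension.{u}) {R : Type u} [Group R] (f : R →* X.C)

/-- The base change of a crossed extension along a homomorphism `R → C`. -/
def baseChange : CrossedExtension.{u} where
  G₂ := X.G₂
  G₁ := MonoidHom.eqLocus (X.p.comp (MonoidHom.fst X.G₁ R)) (f.comp (MonoidHom.snd X.G₁ R))
  action := MulDistribMulAction.compHom X.G₂ ((MonoidHom.fst X.G₁ R).comp (Subgroup.subtype _))
  bd := (X.bd.prod 1).codRestrict _ (fun x => by
    change X.p (X.bd x) = f 1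
    rw [X.p_bd, map_one])
  bd_smul g x := Subtype.ext (Prod.ext (X.bd_smul g.1.1 x) (by
    change 1 = g.1.2 * 1 * g.1.2⁻¹
    group))
  peiffer x y := X.peiffer x y
  B := X.B
  C := R
  j := X.j
  p := (MonoidHom.snd X.G₁ R).comp (Subgroup.subtype _)
  j_injective := X.j_injective
  exact₂ := by
    rw [X.exact₂]
    ext x
    exact ⟨fun h => Subtype.ext (Prod.ext h rfl), 
      fun h => congrArg Prod.fst (congrArg Subtype.val (MonoidHom.mem_ker.mp h))⟩
  exact₁ := by
    ext ⟨⟨g, r⟩, h⟩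
    constructor
    · rintro ⟨x, hx⟩
      exact congrArg (fun g => g.1.2) hx.symm
    · intro hr
      obtain rfl : r = 1 := hr
      obtain ⟨x, rfl⟩ := X.exists_bd (g := g) (Eq.trans h (map_one f))
      exact ⟨x, rfl⟩
  p_surjective r := by
    obtain ⟨g, hg⟩ := X.p_surjective (f r)
    exact ⟨⟨(g, r), hg⟩, rfl⟩

/-- The projection from the base change of a crossed extension. -/
def baseChangeHom : X.baseChange f ⟶ X :=
  { f₂ := MonoidHom.id _
    f₁ := (MonoidHom.fst X.G₁ R).comp (Subgroup.subtype _)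
    β := MonoidHom.id _
    γ := f
    comm := fun _ => rfl
    equivariant := fun _ _ => rfl
    comm_j := fun _ => rfl
    comm_p := fun g => g.2 }

/-- The component into `G₁ ×_C R` must be `k.f₁` paired with `g ∘ p`; nothing else changes. -/
theorem isStronglyCartesian_baseChangeHom :
    piZero.IsStronglyCartesian (piZero.map (X.baseChangeHom f)) (X.baseChangeHom f) := by
  refine isStronglyCartesian_map _ _ fun Z g k hk => ?_
  have hk' : ∀ c, k.γ c = f (g.hom c) := fun c =>
    DFunLike.congr_fun (congrArg GrpCat.Hom.hom hk) c
  refine ⟨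
    { f₂ := k.f₂
      f₁ := (k.f₁.prod (g.hom.comp Z.p)).codRestrict _ (fun z => (k.comm_p z).trans (hk' _))
      β := k.β
      γ := g.hom
      comm := fun x => Subtype.ext (Prod.ext (k.comm x) (by
        change 1 = g.hom (Z.p (Z.bd x))
        rw [Z.p_bd]
        exact (map_one g.hom).symm))
      equivariant := k.equivariant
      comm_j := k.comm_j
      comm_p := fun _ => rfl }, ⟨rfl, hom_ext (fun _ => rfl) (fun _ => rfl)⟩, ?_⟩
  rintro χ ⟨h₁, h₂⟩
  subst h₂
  refine hom_ext (fun z => Subtype.ext (Prod.ext rfl ?_)) (fun _ => rfl)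
  exact (χ.comm_p z).trans (DFunLike.congr_fun (congrArg GrpCat.Hom.hom h₁) _)

/-! ### Pushouts of crossed extensions along a morphism of modules -/

section

variable {M : GroupModule.{u}} (m : X.module ⟶ M)

/-- Elements of `ker ∂` act trivially in the Peiffer identity, so `B` is central in `G₂`. This is
what makes the amalgamated product `G₂ ⊕_B B'` work. -/
theorem j_comm (b : X.B) (x : X.G₂) : x * X.j b = X.j b * x := by
  have h := X.peiffer (X.j b) x
  rw [X.bd_j, one_smul] at h
  exact eq_mul_inv_iff_mul_eq.mp h

/-- The component at `B` of a morphism out of the module of a crossed extension. -/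
def moduleβ : X.B →* M.B := GroupModule.Hom.β m

/-- The component at `C` of a morphism out of the module of a crossed extension. -/
def moduleγ : X.C →* M.C := GroupModule.Hom.γ m

theorem moduleβ_smul (c : X.C) (b : X.B) : X.moduleβ m (c • b) = X.moduleγ m c • X.moduleβ m b :=
  GroupModule.Hom.equivariant m c b

/-- The kernel of `G₂ × B' → G₂ ⊕_B B'`. -/
def pushoutKer : Subgroup (X.G₂ × M.B) := (X.j.prod (X.moduleβ m)⁻¹).range

theorem mem_pushoutKer {x : X.G₂ × M.B} :
    x ∈ X.pushoutKer m ↔ ∃ b, X.j b = x.1 ∧ (X.moduleβ m b)⁻¹ = x.2 :=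
  exists_congr fun _ => Prod.ext_iff

instance : (X.pushoutKer m).Normal where
  conj_mem := by
    rintro _ ⟨b, rfl⟩ ⟨x, c⟩
    refine ⟨b, Prod.ext ?_ ?_⟩
    · change X.j b = x * X.j b * x⁻¹
      rw [X.j_comm, mul_inv_cancel_right]
    · change (X.moduleβ m b)⁻¹ = c * (X.moduleβ m b)⁻¹ * c⁻¹
      rw [mul_comm c, mul_inv_cancel_right]

/-- The group `G₂ ⊕_B B'`. -/
abbrev PushoutGroup : Type u := (X.G₂ × M.B) ⧸ X.pushoutKer m

/-- The class of a pair in `G₂ ⊕_B B'`. -/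
def pushoutMk : X.G₂ × M.B →* X.PushoutGroup m := QuotientGroup.mk' _

theorem pushoutMk_surjective : Function.Surjective (X.pushoutMk m) :=
  QuotientGroup.mk'_surjective _

theorem pushoutMk_eq_one {x : X.G₂ × M.B} :
    X.pushoutMk m x = 1 ↔ ∃ b, X.j b = x.1 ∧ (X.moduleβ m b)⁻¹ = x.2 :=
  (QuotientGroup.eq_one_iff x).trans (X.mem_pushoutKer m)

/-- The homomorphism out of `G₂ ⊕_B B'` induced by a compatible homomorphism out of the product. -/
def pushoutLift {T : Type*} [Group T] (t : X.G₂ × M.B →* T)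
    (ht : ∀ b, t (X.j b, (X.moduleβ m b)⁻¹) = 1) : X.PushoutGroup m →* T :=
  QuotientGroup.lift _ t (by
    rintro _ ⟨b, rfl⟩
    exact ht b)

/-- The action of an element of `G₁` on `G₂ ⊕_B B'`. -/
def pushoutAct (g : X.G₁) : X.PushoutGroup m →* X.PushoutGroup m :=
  X.pushoutLift m ((X.pushoutMk m).comp
    ((MulDistribMulAction.toMonoidHom X.G₂ g).prodMap
      (MulDistribMulAction.toMonoidHom M.B (X.moduleγ m (X.p g))))) fun b =>
    (X.pushoutMk_eq_one m).mpr ⟨X.p g • b, X.j_smul g b, by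
      change _ = X.moduleγ m (X.p g) • (X.moduleβ m b)⁻¹
      rw [moduleβ_smul, smul_inv']⟩

theorem pushoutAct_mk (g : X.G₁) (x : X.G₂) (b : M.B) :
    X.pushoutAct m g (X.pushoutMk m (x, b)) =
      X.pushoutMk m (g • x, X.moduleγ m (X.p g) • b) := rfl

instance : MulDistribMulAction X.G₁ (X.PushoutGroup m) where
  smul g := X.pushoutAct m g
  one_smul q := by
    obtain ⟨⟨x, b⟩, rfl⟩ := X.pushoutMk_surjective m q
    refine (X.pushoutAct_mk m 1 x b).trans ?_
    simp
  mul_smul g h q := by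
    obtain ⟨⟨x, b⟩, rfl⟩ := X.pushoutMk_surjective m q
    refine (X.pushoutAct_mk m (g * h) x b).trans ?_
    rw [map_mul, map_mul, mul_smul, mul_smul]
    rfl
  smul_mul g := map_mul (X.pushoutAct m g)
  smul_one g := map_one (X.pushoutAct m g)

theorem smul_pushoutMk (g : X.G₁) (x : X.G₂) (b : M.B) :
    g • X.pushoutMk m (x, b) = X.pushoutMk m (g • x, X.moduleγ m (X.p g) • b) := rfl

variable (hm : Function.Bijective (X.moduleγ m))

/-- The pushout of a crossed extension along a morphism of modules which is invertible on the
acting groups. -/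
def pushout : CrossedExtension.{u} where
  G₂ := X.PushoutGroup m
  G₁ := X.G₁
  bd := X.pushoutLift m (X.bd.comp (MonoidHom.fst _ _)) X.bd_j
  bd_smul g q := by
    obtain ⟨⟨x, b⟩, rfl⟩ := X.pushoutMk_surjective m q
    exact X.bd_smul g x
  peiffer q r := by
    obtain ⟨⟨x, b⟩, rfl⟩ := X.pushoutMk_surjective m q
    obtain ⟨⟨y, c⟩, rfl⟩ := X.pushoutMk_surjective m r
    refine (X.smul_pushoutMk m (X.bd x) y c).trans (congrArg (X.pushoutMk m)
      (Prod.ext (y := (x, b) * (y, c) * (x, b)⁻¹) (X.peiffer x y) ?_))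
    change X.moduleγ m (X.p (X.bd x)) • c = b * c * b⁻¹
    rw [X.p_bd, map_one, one_smul, mul_comm b, mul_inv_cancel_right]
  B := M.B
  C := M.C
  j := (X.pushoutMk m).comp (MonoidHom.inr _ _)
  p := (X.moduleγ m).comp X.p
  j_injective := by
    refine (injective_iff_map_eq_one _).mpr fun b hb => ?_
    obtain ⟨a, h₁, h₂⟩ := (X.pushoutMk_eq_one m).mp hb
    have h₁' : X.j a = 1 := h₁
    have h₂' : (X.moduleβ m a)⁻¹ = b := h₂
    rw [← h₂', X.j_injective (h₁'.trans (map_one X.j).symm), map_one, inv_one]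
  exact₂ := by
    ext q
    obtain ⟨⟨x, b⟩, rfl⟩ := X.pushoutMk_surjective m q
    constructor
    · rintro ⟨c, hc⟩
      rw [← hc]
      exact map_one X.bd
    · intro h
      obtain ⟨a, rfl⟩ := X.exists_j (x := x) h
      refine ⟨X.moduleβ m a * b, ?_⟩
      change X.pushoutMk m (1, X.moduleβ m a * b) = _
      rw [← inv_mul_eq_one, ← map_inv, ← map_mul, pushoutMk_eq_one]
      refine ⟨a, ?_, ?_⟩
      · change X.j a = 1⁻¹ * X.j a
        rw [inv_one, one_mul]
      · change _ = (X.moduleβ m a * b)⁻¹ * b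
        rw [mul_inv, inv_mul_cancel_right]
  exact₁ := by
    ext g
    constructor
    · rintro ⟨q, rfl⟩
      obtain ⟨⟨x, b⟩, rfl⟩ := X.pushoutMk_surjective m q
      change X.moduleγ m (X.p (X.bd x)) = 1
      rw [X.p_bd, map_one]
    · intro h
      obtain ⟨x, rfl⟩ := X.exists_bd (hm.1 (Eq.trans h (map_one _).symm))
      exact ⟨X.pushoutMk m (x, 1), rfl⟩
  p_surjective := hm.2.comp X.p_surjective

/-- The action on the left is the one extracted by choice from exactness; `j_smul` identifies it
with the given action of `M`, but only propositionally. -/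
theorem pushout_smul (c : M.C) (b : M.B) :
    (show (X.pushout m hm).B from (show (X.pushout m hm).C from c) • (show (X.pushout m hm).B from b))
      = c • b := by
  obtain ⟨g, rfl⟩ := (X.pushout m hm).p_surjective c
  refine (X.pushout m hm).j_injective (((X.pushout m hm).j_smul g b).trans ?_)
  exact (X.smul_pushoutMk m g 1 b).trans (congrArg (X.pushoutMk m) (Prod.ext (smul_one _) rfl))

/-- The inclusion into the pushout of a crossed extension. -/
def pushoutHom : X ⟶ X.pushout m hm :=
  { f₂ := (X.pushoutMk m).comp (MonoidHom.inl _ _)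
    f₁ := MonoidHom.id _
    β := X.moduleβ m
    γ := X.moduleγ m
    comm := fun _ => rfl
    equivariant := fun g x => congrArg (X.pushoutMk m) (Prod.ext rfl (smul_one _).symm)
    comm_j := fun b => by
      change X.pushoutMk m (1, X.moduleβ m b) = X.pushoutMk m (X.j b, 1)
      rw [← inv_mul_eq_one, ← map_inv, ← map_mul, pushoutMk_eq_one]
      refine ⟨b, ?_, ?_⟩
      · change X.j b = 1⁻¹ * X.j b
        rw [inv_one, one_mul]
      · exact (mul_one _).symm
    comm_p := fun _ => rfl }

theorem isHomLift_pushoutHom : piFunctor.IsHomLift m (X.pushoutHom m hm) := by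
  -- The lift must end at `M` itself, while the module of the pushout has the groups of `M` with an
  -- action merely provably equal. Generalizing over the action allows substitution.
  have key : ∀ (a : MulDistribMulAction M.C M.B), a = M.action →
      ∀ f : X.module ⟶ (⟨M.C, M.B⟩ : GroupModule.{u}),
        GroupModule.Hom.γ f = X.moduleγ m → GroupModule.Hom.β f = X.moduleβ m →
          ∃ e : (⟨M.C, M.B⟩ : GroupModule.{u}) = M, f ≫ eqToHom e = m := by
    rintro _ rfl f h₁ h₂
    exact ⟨rfl, (Category.comp_id f).trans (GroupModule.Hom.ext h₁ h₂)⟩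
  obtain ⟨e, he⟩ := key
    (inferInstance : MulDistribMulAction (X.pushout m hm).C (X.pushout m hm).B) (by
      ext c b
      exact X.pushout_smul m hm c b) (piFunctor.map (X.pushoutHom m hm)) rfl rfl
  refine IsHomLift.of_fac _ _ _ rfl e ?_
  exact he.symm.trans (Category.id_comp _).symm

end

end CrossedExtension

theorem isStronglyCocartesian_of_isHomLift {X : Type w₁} {B : Type w₂} [Category.{v₁} X]
    [Category.{v₂} B] {p : X ⥤ B} {a b : X} {R S : B} {f : R ⟶ S} {φ : a ⟶ b}
    (h : p.IsStronglyCocartesian (p.map φ) φ) (hf : p.IsHomLift f φ) :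
    p.IsStronglyCocartesian f φ := by
  obtain ⟨⟩ := hf
  exact h

namespace CrossedExtension

variable (X : CrossedExtension.{u}) {M : GroupModule.{u}} (m : X.module ⟶ M)
  (hm : Function.Bijective (X.moduleγ m))

theorem pushoutHom_mul_j (x : X.G₂) (b : M.B) :
    (X.pushoutHom m hm).f₂ x * (X.pushout m hm).j b = X.pushoutMk m (x, b) :=
  (map_mul (X.pushoutMk m) (x, 1) (1, b)).symm.trans
    (congrArg (X.pushoutMk m) (Prod.ext (mul_one _) (one_mul _)))

/-- A morphism out of the module of the pushout is compatible with the action of `M`. -/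
theorem moduleβ_pushout_smul {Z : CrossedExtension.{u}}
    (n : (X.pushout m hm).module ⟶ Z.module) (c : M.C) (b : M.B) {d : Z.C}
    (hd : (X.pushout m hm).moduleγ n c = d) :
    (show Z.B from (X.pushout m hm).moduleβ n (c • b : M.B)) =
      d • show Z.B from (X.pushout m hm).moduleβ n b := by
  subst hd
  exact (congrArg ((X.pushout m hm).moduleβ n) (X.pushout_smul m hm c b)).symm.trans
    ((X.pushout m hm).moduleβ_smul n c b)

/-- The factorization sends `[x, b]` to `e.f₂ x * j (nβ b)`, a homomorphism by centrality of `Z.B`.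
It is unique because the images of `G₂` and `B'` generate the pushout. -/
theorem isStronglyCocartesian_pushoutHom :
    piFunctor.IsStronglyCocartesian (piFunctor.map (X.pushoutHom m hm)) (X.pushoutHom m hm) := by
  refine isStronglyCocartesian_map _ _ fun Z n e he => ?_
  let nβ : M.B →* Z.B := (X.pushout m hm).moduleβ n
  let nγ : M.C →* Z.C := (X.pushout m hm).moduleγ n
  have hβ (b : X.B) : e.β b = nβ (X.moduleβ m b) :=
    DFunLike.congr_fun (congrArg GroupModule.Hom.β he) b
  have hγ (c : X.C) : e.γ c = nγ (X.moduleγ m c) :=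
    DFunLike.congr_fun (congrArg GroupModule.Hom.γ he) c
  let t : X.G₂ × M.B →* Z.G₂ := e.f₂.noncommCoprod (Z.j.comp nβ) fun x b => Z.j_comm (nβ b) (e.f₂ x)
  have ht (b : X.B) : t (X.j b, (X.moduleβ m b)⁻¹) = 1 := by
    change e.f₂ (X.j b) * Z.j (nβ (X.moduleβ m b)⁻¹) = 1
    rw [map_inv, map_inv, ← e.comm_j, hβ, mul_inv_cancel]
  let d : X.pushout m hm ⟶ Z :=
    { f₂ := X.pushoutLift m t ht
      f₁ := e.f₁
      β := nβ
      γ := nγ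
      comm := fun q => by
        obtain ⟨⟨x, b⟩, rfl⟩ := X.pushoutMk_surjective m q
        change Z.bd (e.f₂ x * Z.j (nβ b)) = e.f₁ (X.bd x)
        rw [map_mul, Z.bd_j, mul_one, e.comm]
      equivariant := fun g q => by
        obtain ⟨⟨x, b⟩, rfl⟩ := X.pushoutMk_surjective m q
        change e.f₂ ((show X.G₁ from g) • x) * Z.j (nβ (X.moduleγ m (X.p g) • b)) =
          e.f₁ g • (e.f₂ x * Z.j (nβ b))
        have h : nβ (X.moduleγ m (X.p g) • b) = Z.p (e.f₁ g) • nβ b :=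
          X.moduleβ_pushout_smul m hm n _ b ((hγ _).symm.trans (e.comm_p g).symm)
        rw [h, smul_mul', Z.j_smul, e.equivariant]
      comm_j := fun b => by
        change Z.j (nβ b) = e.f₂ 1 * Z.j (nβ b)
        rw [map_one, one_mul]
      comm_p := fun g => (e.comm_p g).trans (hγ _) }
  refine ⟨d, ⟨GroupModule.Hom.ext rfl rfl, hom_ext (fun _ => rfl) fun x => ?_⟩, ?_⟩
  · change e.f₂ x * Z.j (nβ 1) = e.f₂ x
    rw [map_one, map_one, mul_one]
  · rintro χ ⟨h₁, h₂⟩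
    subst h₂
    refine hom_ext (fun _ => rfl) fun q => ?_
    obtain ⟨⟨x, b⟩, rfl⟩ := X.pushoutMk_surjective m q
    refine (congrArg χ.f₂ (X.pushoutHom_mul_j m hm x b)).symm.trans ((map_mul χ.f₂ _ _).trans ?_)
    refine congrArg (χ.f₂ _ * ·) ((χ.comm_j b).symm.trans (congrArg Z.j ?_))
    exact DFunLike.congr_fun (congrArg GroupModule.Hom.β h₁) b

/-- Base change leaves `B` untouched, so its image in modules has identity `β` and is cartesian. -/
theorem isFibredFunctor_piFunctor :
    IsFibredFunctor piFunctor.{u} piZero GroupModule.actingGroup :=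
  IsFibredFunctor.of_lifts rfl GroupModule.isFibered_actingGroup fun X _ f =>
    ⟨X.baseChange f.hom, X.baseChangeHom f.hom, X.isStronglyCartesian_baseChangeHom f.hom,
      GroupModule.isStronglyCartesian_of_bijective _ Function.bijective_id⟩

theorem moduleγ_bijective (h : IsIso (GroupModule.actingGroup.map m)) :
    Function.Bijective (X.moduleγ m) :=
  @ConcreteCategory.bijective_of_isIso GrpCat _ _ _ _ _ _ _ (GroupModule.actingGroup.map m) h

theorem isFibrewiseOpfibration_piFunctor :
    IsFibrewiseOpfibration piFunctor.{u} piZero GroupModule.actingGroup where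
  toIsFibredFunctor := isFibredFunctor_piFunctor
  opfibration_fibre b := isOpfibration_fibreRestriction _ b fun X M m hm => by
    have hγ := X.moduleγ_bijective m hm
    exact ⟨_, X.pushoutHom m hγ, isStronglyCocartesian_of_isHomLift
      (X.isStronglyCocartesian_pushoutHom m hγ) (X.isHomLift_pushoutHom m hγ)⟩

end CrossedExtension

/-! ### The functor `P` -/

namespace BExt

open CrossedExtension

variable {X Y Z : CrossedExtension.{u}}

theorem isInvertedBy_piFunctor : weakEquivalences.{u}.IsInvertedBy piFunctor.{u} :=
  fun _ _ _ h => h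

/-- The functor `P : [BExt](Gp) ⥤ Mod(Gp)` induced by `Π`. -/
noncomputable def moduleFunctor : BExt.{u} ⥤ GroupModule.{u} :=
  lift piFunctor isInvertedBy_piFunctor

/-- The morphism of modules induced by a butterfly. -/
noncomputable def moduleMap (E : Butterfly X.toCrossedModule Y.toCrossedModule) :
    X.module ⟶ Y.module :=
  liftMap piFunctor isInvertedBy_piFunctor E

theorem moduleMap_γ (E : Butterfly X.toCrossedModule Y.toCrossedModule) (e : E.E) :
    X.moduleγ (moduleMap E) (X.p (E.δ e)) = Y.p (E.γ e) := by
  have h := DFunLike.congr_fun (congrArg GroupModule.Hom.γ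
    (left_liftMap piFunctor isInvertedBy_piFunctor E)) ((apex E).p e)
  refine Eq.trans h (((right E).comm_p e).symm.trans (congrArg Y.p (right_f₁ E e)))

/-- In the apex, `j b` is the pair formed by `j b` and `j` of its image, and it lies in the kernel
of `(x, y) ↦ κ x * ι y`. As `ι` and `j` are injective, the relation determines the induced map on
`B`. -/
theorem moduleMap_β (E : Butterfly X.toCrossedModule Y.toCrossedModule) (b : X.B) :
    E.κ (X.j b) * E.ι (Y.j (X.moduleβ (moduleMap E) b)) = 1 := by
  have h := DFunLike.congr_fun (congrArg GroupModule.Hom.β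
    (left_liftMap piFunctor isInvertedBy_piFunctor E)) b
  have h₁ : ((apex E).j b : X.G₂ × Y.G₂).1 = X.j b := ((left E).comm_j b).symm
  have h₂ : ((apex E).j b : X.G₂ × Y.G₂).2 = Y.j (X.moduleβ (moduleMap E) b) :=
    (right_f₂ E ((apex E).j b)).symm.trans
      (((right E).comm_j b).symm.trans (congrArg Y.j (Eq.symm h)))
  rw [← h₁, ← h₂]
  exact (apex E).bd_j b

theorem moduleβ_eq_of (E : Butterfly X.toCrossedModule Y.toCrossedModule) {b : X.B} {b' : Y.B}
    (h : E.κ (X.j b) * E.ι (Y.j b') = 1) : X.moduleβ (moduleMap E) b = b' :=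
  Y.j_injective (E.ι_injective (mul_left_cancel ((moduleMap_β E b).trans h.symm)))

theorem moduleγ_eq_of (E : Butterfly X.toCrossedModule Y.toCrossedModule) (f : X.C →* Y.C)
    (h : ∀ e, f (X.p (E.δ e)) = Y.p (E.γ e)) : X.moduleγ (moduleMap E) = f := by
  ext c
  obtain ⟨g, rfl⟩ := X.p_surjective c
  obtain ⟨e, rfl⟩ := E.δ_surjective g
  exact (moduleMap_γ E e).trans (h e).symm

theorem moduleFunctor_map_Q (f : X ⟶ Y) : moduleFunctor.map (Q.map f) = piFunctor.map f :=
  liftMap_ofHom piFunctor isInvertedBy_piFunctor f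

/-- If the fraction and its left leg become invertible in modules, so does the right leg. It is then
a weak equivalence, which `Q` inverts. -/
instance : moduleFunctor.{u}.ReflectsIsomorphisms where
  reflects := by
    suffices H : ∀ {X Y : CrossedExtension.{u}} (f : Q.obj X ⟶ Q.obj Y),
        IsIso (moduleFunctor.map f) → IsIso f from
      fun {X Y} f hf => H (X := X) (Y := Y) f hf
    intro X Y f hf
    obtain ⟨E, rfl⟩ := homMk_surjective f
    have : IsIso (piFunctor.map (left E)) := weakEquivalences_left E
    have : IsIso (moduleMap E) := hf
    have h : IsIso (piFunctor.map (right E)) := by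
      rw [← left_liftMap piFunctor isInvertedBy_piFunctor E]
      exact IsIso.comp_isIso' ‹_› ‹_›
    have : IsIso (Q.map (left E)) := isInvertedBy_Q _ (weakEquivalences_left E)
    have : IsIso (Q.map (right E)) := isInvertedBy_Q _ h
    have hE : homMk E = inv (Q.map (left E)) ≫ Q.map (right E) := by
      rw [IsIso.eq_inv_comp, Q_left_comp]
    rw [hE]
    infer_instance

/-! #### Cartesian morphisms -/

section BaseChange

variable (X) {R : Type u} [Group R] (f : R →* X.C)

/-- The composite of a butterfly with the projection from a base change. -/
def ofBaseChange (E : Butterfly Z.toCrossedModule (X.baseChange f).toCrossedModule) :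
    Butterfly Z.toCrossedModule X.toCrossedModule where
  E := E.E
  κ := E.κ
  ι := E.ι
  δ := E.δ
  γ := (X.baseChangeHom f).f₁.comp E.γ
  δ_κ := E.δ_κ
  γ_ι y := congrArg (X.baseChangeHom f).f₁ (E.γ_ι y)
  γ_κ x := congrArg (X.baseChangeHom f).f₁ (E.γ_κ x)
  ι_injective := E.ι_injective
  exact := E.exact
  δ_surjective := E.δ_surjective
  κ_smul := E.κ_smul
  ι_smul := E.ι_smul

theorem homMk_comp_baseChangeHom
    (E : Butterfly Z.toCrossedModule (X.baseChange f).toCrossedModule) :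
    homMk E ≫ Q.map (X.baseChangeHom f) = homMk (ofBaseChange X f E) :=
  homMk_eq (Butterfly.comp_ofHom_isomorphic E (X.baseChangeHom f).toHom (ofBaseChange X f E)
    (MonoidHom.id _) (fun _ => rfl) (fun _ => rfl) (fun _ => rfl) (fun _ => rfl))

/-- The factorization of a butterfly through a base change. -/
def toBaseChange (E : Butterfly Z.toCrossedModule X.toCrossedModule) (g : Z.C →* R)
    (hg : ∀ e, X.p (E.γ e) = f (g (Z.p (E.δ e)))) :
    Butterfly Z.toCrossedModule (X.baseChange f).toCrossedModule where
  E := E.E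
  κ := E.κ
  ι := E.ι
  δ := E.δ
  γ := (E.γ.prod ((g.comp Z.p).comp E.δ)).codRestrict _ hg
  δ_κ := E.δ_κ
  γ_ι y := Subtype.ext (Prod.ext (E.γ_ι y) (by
    refine (congrArg (fun d => g (Z.p d)) (E.δ_ι (show X.G₂ from y))).trans ?_
    exact (congrArg g (map_one Z.p)).trans (map_one g)))
  γ_κ x := Subtype.ext (Prod.ext (E.γ_κ x) (by
    change g (Z.p (E.δ (E.κ x))) = 1
    rw [E.δ_κ, Z.p_bd, map_one]))
  ι_injective := E.ι_injective
  exact := E.exact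
  δ_surjective := E.δ_surjective
  κ_smul := E.κ_smul
  ι_smul := E.ι_smul

/-- A 2-cell after projection already respects everything except the `R`-component of `γ`; by
`moduleMap_γ` that component depends only on `δ` and the induced map on `C`. -/
theorem homMk_eq_of_comp_baseChangeHom
    {E F : Butterfly Z.toCrossedModule (X.baseChange f).toCrossedModule}
    (hγ : Z.moduleγ (moduleMap E) = Z.moduleγ (moduleMap F))
    (h : homMk E ≫ Q.map (X.baseChangeHom f) = homMk F ≫ Q.map (X.baseChangeHom f)) :
    homMk E = homMk F := by
  rw [homMk_comp_baseChangeHom, homMk_comp_baseChangeHom] at h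
  obtain ⟨φ, -⟩ := isomorphic_of_homMk_eq h
  have hδ : ∀ e : E.E, F.δ (φ.α e) = E.δ e := φ.δ_α
  refine homMk_eq (Butterfly.Hom.isomorphic ⟨φ.α, φ.α_κ, φ.α_ι, φ.δ_α, fun e =>
    Subtype.ext (Prod.ext (φ.γ_α e) ?_)⟩)
  refine (moduleMap_γ F (φ.α e)).symm.trans (Eq.trans ?_ (moduleMap_γ E e))
  rw [hδ, hγ]

theorem isStronglyCartesian_Q_baseChangeHom :
    (moduleFunctor ⋙ GroupModule.actingGroup).IsStronglyCartesian
      ((moduleFunctor ⋙ GroupModule.actingGroup).map (Q.map (X.baseChangeHom f)))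
      (Q.map (X.baseChangeHom f)) := by
  refine isStronglyCartesian_map _ _ fun (Z : CrossedExtension.{u}) g k hk => ?_
  obtain ⟨E, rfl⟩ := homMk_surjective (X := Z) (Y := X) k
  let g' : Z.C →* R := GrpCat.Hom.hom g
  have hc : (moduleFunctor ⋙ GroupModule.actingGroup).map (Q.map (X.baseChangeHom f)) =
      GroupModule.actingGroup.map (piFunctor.map (X.baseChangeHom f)) :=
    congrArg GroupModule.actingGroup.map (moduleFunctor_map_Q (X.baseChangeHom f))
  rw [hc] at hk
  have hk' : ∀ c, Z.moduleγ (moduleMap E) c = f (g' c) := fun c =>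
    DFunLike.congr_fun (congrArg GrpCat.Hom.hom hk) c
  have hg (e : E.E) : X.p (E.γ e) = f (g' (Z.p (E.δ e))) :=
    (moduleMap_γ E e).symm.trans (hk' _)
  have hF : Z.moduleγ (moduleMap (toBaseChange X f E g' hg)) = g' :=
    moduleγ_eq_of (toBaseChange X f E g' hg) g' fun _ => rfl
  refine ⟨homMk (toBaseChange X f E g' hg), ⟨GrpCat.hom_ext hF,
    homMk_comp_baseChangeHom X f (toBaseChange X f E g' hg)⟩, ?_⟩
  rintro χ ⟨h₁, h₂⟩
  obtain ⟨F, rfl⟩ := homMk_surjective (X := Z) (Y := X.baseChange f) χ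
  refine homMk_eq_of_comp_baseChangeHom X f (Z := Z) ?_
    (h₂.trans (homMk_comp_baseChangeHom X f (toBaseChange X f E g' hg)).symm)
  exact (congrArg GrpCat.Hom.hom h₁).trans hF.symm

end BaseChange

/-! #### Opcartesian morphisms -/

section Pushout

variable (X) {M : GroupModule.{u}} (m : X.module ⟶ M) (hm : Function.Bijective (X.moduleγ m))

/-- The composite of the inclusion into a pushout with a butterfly. -/
def ofPushout (E : Butterfly (X.pushout m hm).toCrossedModule Z.toCrossedModule) :
    Butterfly X.toCrossedModule Z.toCrossedModule where
  E := E.E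
  κ := E.κ.comp (X.pushoutHom m hm).f₂
  ι := E.ι
  δ := E.δ
  γ := E.γ
  δ_κ _ := E.δ_κ _
  γ_ι := E.γ_ι
  γ_κ _ := E.γ_κ _
  ι_injective := E.ι_injective
  exact := E.exact
  δ_surjective := E.δ_surjective
  κ_smul e x := (congrArg E.κ ((X.pushoutHom m hm).equivariant (E.δ e) x)).trans (E.κ_smul e _)
  ι_smul := E.ι_smul

theorem pushoutHom_comp_homMk
    (E : Butterfly (X.pushout m hm).toCrossedModule Z.toCrossedModule) :
    Q.map (X.pushoutHom m hm) ≫ homMk E = homMk (ofPushout X m hm E) :=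
  (homMk_eq (Butterfly.isomorphic_ofHom_comp (X.pushoutHom m hm).toHom E (ofPushout X m hm E)
    (MonoidHom.id _) (fun _ => rfl) (fun _ => rfl) (fun _ => rfl) (fun _ => rfl))).symm

/-- A 2-cell between the restrictions respects `κ` on the image of `G₂`. On `B'`, `moduleMap_β`
expresses `κ ∘ j` through `ι` and the induced module map, and the two images generate. -/
theorem homMk_eq_of_pushoutHom_comp
    {E F : Butterfly (X.pushout m hm).toCrossedModule Z.toCrossedModule}
    (hβ : (X.pushout m hm).moduleβ (moduleMap E) = (X.pushout m hm).moduleβ (moduleMap F))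
    (h : Q.map (X.pushoutHom m hm) ≫ homMk E = Q.map (X.pushoutHom m hm) ≫ homMk F) :
    homMk E = homMk F := by
  rw [pushoutHom_comp_homMk, pushoutHom_comp_homMk] at h
  obtain ⟨φ, -⟩ := isomorphic_of_homMk_eq h
  let α : E.E →* F.E := φ.α
  have hκ : ∀ x, α (E.κ ((X.pushoutHom m hm).f₂ x)) = F.κ ((X.pushoutHom m hm).f₂ x) := φ.α_κ
  have hι : ∀ y, α (E.ι y) = F.ι y := φ.α_ι
  refine homMk_eq (Butterfly.Hom.isomorphic ⟨α, fun q => ?_, hι, φ.δ_α, φ.γ_α⟩)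
  obtain ⟨⟨x, b⟩, rfl⟩ := X.pushoutMk_surjective m q
  have hE := eq_inv_of_mul_eq_one_left (moduleMap_β E b)
  have hF := eq_inv_of_mul_eq_one_left (moduleMap_β F b)
  have hj : α (E.κ ((X.pushout m hm).j b)) = F.κ ((X.pushout m hm).j b) := by
    rw [hE, hF, map_inv, hι, hβ]
  rw [← X.pushoutHom_mul_j m hm x b]
  exact (congrArg α (map_mul E.κ _ _)).trans ((map_mul α _ _).trans
    ((congrArg₂ (· * ·) (hκ x) hj).trans (map_mul F.κ _ _).symm))

/-- The extension of a butterfly to a pushout. -/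
noncomputable def toPushout (E : Butterfly X.toCrossedModule Z.toCrossedModule)
    (n : (X.pushout m hm).module ⟶ Z.module)
    (hn : moduleMap E = piFunctor.map (X.pushoutHom m hm) ≫ n) :
    Butterfly (X.pushout m hm).toCrossedModule Z.toCrossedModule :=
  let nβ : M.B →* Z.B := (X.pushout m hm).moduleβ n
  have hβ (b : X.B) : X.moduleβ (moduleMap E) b = nβ (X.moduleβ m b) :=
    DFunLike.congr_fun (congrArg GroupModule.Hom.β hn) b
  have hγ (c : X.C) : X.moduleγ (moduleMap E) c =
      (X.pushout m hm).moduleγ n (X.moduleγ m c) :=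
    DFunLike.congr_fun (congrArg GroupModule.Hom.γ hn) c
  { E := E.E
    -- The formula `[x, b] ↦ κ x * ι (j (nβ b⁻¹))` is forced by `moduleMap_β`; the inverse reflects
    -- the relation `κ (j b) * ι (j (nβ b)) = 1`.
    κ := X.pushoutLift m (E.κ.noncommCoprod ((E.ι.comp (Z.j.comp nβ)).comp invMonoidHom)
      fun _ _ => E.κ_ι_comm _ _) fun b => by
        change E.κ (X.j b) * E.ι (Z.j (nβ (X.moduleβ m b)⁻¹⁻¹)) = 1
        rw [inv_inv, ← hβ, moduleMap_β]
    ι := E.ι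
    δ := E.δ
    γ := E.γ
    δ_κ := fun q => by
      obtain ⟨⟨x, b⟩, rfl⟩ := X.pushoutMk_surjective m q
      change E.δ (E.κ x * E.ι (Z.j (nβ b⁻¹))) = X.bd x
      rw [map_mul, E.δ_κ, E.δ_ι, mul_one]
    γ_ι := E.γ_ι
    γ_κ := fun q => by
      obtain ⟨⟨x, b⟩, rfl⟩ := X.pushoutMk_surjective m q
      change E.γ (E.κ x * E.ι (Z.j (nβ b⁻¹))) = 1
      rw [map_mul, E.γ_κ, E.γ_ι, Z.bd_j, mul_one]
    ι_injective := E.ι_injective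
    exact := E.exact
    δ_surjective := E.δ_surjective
    κ_smul := fun e q => by
      obtain ⟨⟨x, b⟩, rfl⟩ := X.pushoutMk_surjective m q
      change E.κ (E.δ e • x) * E.ι (Z.j (nβ (X.moduleγ m (X.p (E.δ e)) • b)⁻¹)) =
        e * (E.κ x * E.ι (Z.j (nβ b⁻¹))) * e⁻¹
      have h : nβ (X.moduleγ m (X.p (E.δ e)) • b⁻¹) = Z.p (E.γ e) • nβ b⁻¹ :=
        X.moduleβ_pushout_smul m hm n _ b⁻¹ ((hγ _).symm.trans (moduleMap_γ E e))
      rw [← smul_inv', h, Z.j_smul, E.ι_smul, E.κ_smul]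
      group
    ι_smul := E.ι_smul }

theorem isStronglyCocartesian_Q_pushoutHom :
    moduleFunctor.IsStronglyCocartesian (moduleFunctor.map (Q.map (X.pushoutHom m hm)))
      (Q.map (X.pushoutHom m hm)) := by
  refine isStronglyCocartesian_map _ _ fun (Z : CrossedExtension.{u}) n k hk => ?_
  obtain ⟨E, rfl⟩ := homMk_surjective (X := X) (Y := Z) k
  change (X.pushout m hm).module ⟶ Z.module at n
  have hn : moduleMap E = piFunctor.map (X.pushoutHom m hm) ≫ n :=
    Eq.trans hk (congrArg (· ≫ n) (moduleFunctor_map_Q (X.pushoutHom m hm)))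
  let F := toPushout X m hm E n hn
  have hQ : Q.map (X.pushoutHom m hm) ≫ homMk F = homMk E := by
    refine (homMk_eq (Butterfly.isomorphic_ofHom_comp (X.pushoutHom m hm).toHom F E
      (MonoidHom.id _) (fun x => ?_) (fun _ => rfl) (fun _ => rfl) (fun _ => rfl))).symm
    change E.κ x = E.κ x * E.ι (Z.j ((X.pushout m hm).moduleβ n 1⁻¹))
    rw [inv_one]
    exact ((congrArg (E.κ x * ·) ((congrArg (fun b => E.ι (Z.j b)) (map_one _)).trans
      ((congrArg E.ι (map_one _)).trans (map_one _)))).trans (mul_one _)).symm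
  have hF : moduleMap F = n := by
    refine GroupModule.Hom.ext ?_ (MonoidHom.ext fun b => ?_)
    · refine moduleγ_eq_of F ((X.pushout m hm).moduleγ n) fun e => ?_
      exact (DFunLike.congr_fun (congrArg GroupModule.Hom.γ hn) (X.p (E.δ e))).symm.trans
        (moduleMap_γ E e)
    · let nβ : M.B →* Z.B := (X.pushout m hm).moduleβ n
      have h (b : M.B) : E.κ 1 * E.ι (Z.j (nβ b⁻¹)) * E.ι (Z.j (nβ b)) = 1 := by
        rw [map_one, one_mul, map_inv, map_inv, map_inv, inv_mul_cancel]
      exact moduleβ_eq_of F (h b)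
  refine ⟨homMk F, ⟨hF, hQ⟩, ?_⟩
  rintro χ ⟨h₁, h₂⟩
  obtain ⟨F', rfl⟩ := homMk_surjective (X := X.pushout m hm) (Y := Z) χ
  refine homMk_eq_of_pushoutHom_comp X m hm (Z := Z) ?_ (h₂.trans hQ.symm)
  exact congrArg GroupModule.Hom.β (Eq.trans h₁ hF.symm)

end Pushout

/-! ### `P` and `Q` as functors over `Gp`. -/

theorem isFibredFunctor_moduleFunctor :
    IsFibredFunctor moduleFunctor.{u} (moduleFunctor ⋙ GroupModule.actingGroup)
      GroupModule.actingGroup :=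
  IsFibredFunctor.of_lifts rfl GroupModule.isFibered_actingGroup
    fun (X : CrossedExtension.{u}) R f => by
      have h := moduleFunctor_map_Q (X.baseChangeHom f.hom)
      have hc := isStronglyCartesian_Q_baseChangeHom X f.hom
      refine ⟨Q.obj (X.baseChange f.hom), Q.map (X.baseChangeHom f.hom), ?_, ?_⟩
      · have hf : (moduleFunctor ⋙ GroupModule.actingGroup).map (Q.map (X.baseChangeHom f.hom)) =
            f := congrArg GroupModule.actingGroup.map h
        rw [hf] at hc
        exact hc
      · exact GroupModule.isStronglyCartesian_of_bijective _
          ((congrArg (fun k => Function.Bijective (GroupModule.Hom.β k)) h).mpr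
            Function.bijective_id)

theorem isFibredFunctor_Q :
    IsFibredFunctor Q.{u} piZero (moduleFunctor ⋙ GroupModule.actingGroup) :=
  IsFibredFunctor.of_lifts
    (congrArg (· ⋙ GroupModule.actingGroup) (Q_comp_lift piFunctor isInvertedBy_piFunctor))
    isFibredFunctor_moduleFunctor.isFibered_left fun X _ f =>
      ⟨X.baseChange f.hom, X.baseChangeHom f.hom, X.isStronglyCartesian_baseChangeHom f.hom,
        isStronglyCartesian_Q_baseChangeHom X f.hom⟩

theorem isFibrewiseOpfibration_moduleFunctor :
    IsFibrewiseOpfibration moduleFunctor.{u} (moduleFunctor ⋙ GroupModule.actingGroup)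
      GroupModule.actingGroup where
  toIsFibredFunctor := isFibredFunctor_moduleFunctor
  opfibration_fibre b := isOpfibration_fibreRestriction _ b
    fun (X : CrossedExtension.{u}) M m hm => by
      change X.module ⟶ M at m
      have hγ := X.moduleγ_bijective m hm
      refine ⟨Q.obj (X.pushout m hγ), Q.map (X.pushoutHom m hγ),
        isStronglyCocartesian_of_isHomLift (isStronglyCocartesian_Q_pushoutHom X m hγ) ?_⟩
      have hl := X.isHomLift_pushoutHom m hγ
      -- `P` and `Π` agree definitionally on objects but only propositionally on morphisms, so the
      -- lifting property is transported along `moduleFunctor_map_Q`.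
      exact IsHomLift.of_fac moduleFunctor m _ (@IsHomLift.domain_eq _ _ _ _ piFunctor _ _ _ _ m _ hl)
        (@IsHomLift.codomain_eq _ _ _ _ piFunctor _ _ _ _ m _ hl)
        ((@IsHomLift.fac _ _ _ _ piFunctor _ _ _ _ m _ hl).trans
          (congrArg (fun k => eqToHom _ ≫ k ≫ eqToHom _) (moduleFunctor_map_Q _).symm))

end BExt

theorem proposition6p5 :
    -- `Q` inverts weak equivalences and is strictly universal with this property
    (CrossedExtension.weakEquivalences.{u}.IsInvertedBy Q.{u} ∧
      ∀ (D : Type w₁) [Category.{v₁} D] (F : CrossedExtension.{u} ⥤ D),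
        CrossedExtension.weakEquivalences.{u}.IsInvertedBy F →
          ∃! F' : BExt.{u} ⥤ D, Q ⋙ F' = F) ∧
    Q.{u}.IsLocalization CrossedExtension.weakEquivalences.{u} ∧
    -- the factorization `Π = P · Q` over `Gp`
    IsFibrewiseOpfibration CrossedExtension.piFunctor.{u} CrossedExtension.piZero
      GroupModule.actingGroup ∧
    ∃ P : BExt.{u} ⥤ GroupModule.{u},
      Q ⋙ P = CrossedExtension.piFunctor ∧
      IsFibredFunctor Q.{u} CrossedExtension.piZero (P ⋙ GroupModule.actingGroup) ∧
      IsFibrewiseOpfibration P (P ⋙ GroupModule.actingGroup) GroupModule.actingGroup ∧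
      ∀ M : GroupModule.{u}, IsGroupoid (P.Fiber M) := by
  refine ⟨⟨BExt.isInvertedBy_Q, fun D _ F hF => ⟨BExt.lift F hF, BExt.Q_comp_lift F hF,
    fun F' h => BExt.functor_ext _ _ (h.trans (BExt.Q_comp_lift F hF).symm)⟩⟩,
    -- The strict universal property is applied to two targets: the constructed localization and
    -- `[BExt](Gp)` itself.
    Functor.IsLocalization.mk' _ _ (BExt.strictUniversalProperty _)
      (BExt.strictUniversalProperty _),
    CrossedExtension.isFibrewiseOpfibration_piFunctor, BExt.moduleFunctor,
    BExt.Q_comp_lift _ BExt.isInvertedBy_piFunctor, BExt.isFibredFunctor_Q,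
    BExt.isFibrewiseOpfibration_moduleFunctor, fun M => isGroupoid_fiber _ M⟩
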